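/- Let $\mu\in\mathbb R$, $\sigma>0$, $L>0$ and $x\in\mathbb R^2$. For $\theta=(\cos t,\sin t)\in S^1$ put $\theta^\perp=(-\sin t,\cos t)$, and let $T_\mu f(\theta,s)=\int_{\mathbb R}e^{\mu u}f(s\theta+u\theta^\perp)\,du$ be the exponential Radon transform (ERT). One observes $(\theta_i,s_i,Y_i)$, $1\le i\le n$, with $Y_i=T_\mu f(\theta_i,s_i)+\epsilon_i$, where the $(\theta_i,s_i)$ are i.i.d. uniform on $S^1\times[-1,1]$, the $\epsilon_i$ are i.i.d. $N(0,\sigma^2)$ and independent of the design points; $E_f$ is the expectation under this model. Estimator. For $\delta>0$ let $K_\delta(s)=\frac1\pi\int_{|\mu|}^{\sqrt{\delta^{-2}+\mu^2}}r\cos(sr)\,dr$ and $\bar f_\delta(x)=\frac1n\sum_{i=1}^n e^{-\mu x\cdot\theta_i^\perp}K_\delta(x\cdot\theta_i-s_i)Y_i$. Given constants $c_1,c_2>0$, $D>0$ and $a\ge2$, let $\Delta_n=\{a^{-j}: j=0,1,2,\dots\}\cap[\frac{\log n}{n},1]$, $v(\delta)=(c_1\delta^{-3}/n)^{1/2}$,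 $v(\delta,\eta)=\big(\frac{c_2}{n}\int_{\mathbb R}(K_\delta-K_\eta)^2\big)^{1/2}$, $\lambda(\delta)=\max\big(1,\sqrt{D\log(1/\delta)}\big)$ and $\psi(\delta,\eta)=v(\delta)\lambda(\delta)+v(\delta,\eta)\lambda(\eta)$. The adaptive estimator is $f^*(x)=\bar f_{\bar\delta(x)}(x)$, where $$\bar\delta(x)=\max\{\delta\in\Delta_n:\ |\bar f_\delta(x)-\bar f_\eta(x)|\le\psi(\delta,\eta)\ \text{ for all }\eta\in\Delta_n,\ \eta\le\delta\}.$$ Classes. $B(L)$ is the set of functions $f:\mathbb R^2\to\mathbb R$ that vanish outside the closed unit disc, are continuous almost everywhere and satisfy $|f|\le L$; $H(\beta,C)$ is the set of $f$ with $\int_{\mathbb R^2}(1+\|\xi\|^2)^\beta|\tilde f(\xi)|^2d\xi\le C$, where $\tilde f(\xi)=\int e^{-iy\cdot\xi}f(y)\,dy$. Let $\mathcal F_x(\beta,C,L)$ be the set of $f\in H(\beta,C)\cap B(L)$ that are continuous at $x$. Theorem. For all $c_1,c_2>0$ there is a $D_0$ (depending only on $\mu,\sigma,L,x,c_1,c_2$)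 such that for every $D\ge D_0$ and every $a\ge2$ the estimator $f^*(x)$, whose construction does not involve $\beta$ or $C$, satisfies for every $\beta>1$ and every $C>0$ $$\limsup_{n\to\infty}\ \sup_{f\in\mathcal F_x(\beta,C,L)}\Big(\frac{n}{\log n}\Big)^{\frac{2\beta-2}{2\beta+1}}E_f\big(f^*(x)-f(x)\big)^2<\infty .$$ -/

import Mathlib

open MeasureTheory ProbabilityTheory Filter Set
open scoped FourierTransform ENNReal

noncomputable section

namespace ERT

/-- The Euclidean plane. -/
abbrev Plane : Type := EuclideanSpace ℝ (Fin 2)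

/-- The point `θ` of the unit circle with angle `t`. -/
def dir (t : ℝ) : Plane := !₂[Real.cos t, Real.sin t]

/-- The unit vector `θ^⊥` perpendicular to `dir t`. -/
def perp (t : ℝ) : Plane := !₂[-Real.sin t, Real.cos t]

/-- The exponential Radon transform `T_μ f (θ, s) = ∫_{x·θ = s} e^{μ x·θ^⊥} f(x) dx`, with `θ = dir t`
and the line `{x | x·θ = s}` parametrized by arc length as `u ↦ s θ + u θ^⊥`. -/
def transform (μ : ℝ) (f : Plane → ℝ) (t s : ℝ) : ℝ :=
  ∫ u : ℝ, Real.exp (μ * u) * f (s • dir t + u • perp t)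

/-- The class `B(L)`: functions supported in the closed unit disc, continuous almost everywhere and
bounded by `L`. -/
def classB (L : ℝ) : Set (Plane → ℝ) :=
  {f | (∀ y, 1 < ‖y‖ → f y = 0) ∧ (∀ᵐ y ∂(volume : Measure Plane), ContinuousAt f y) ∧
    ∀ y, |f y| ≤ L}

/-- The Fourier transform `∫ e^{-i y·ξ} f(y) dy`. Mathlib's `𝓕` has `e^{-2π i y·ξ}`. -/
def fourierAngular (f : Plane → ℝ) (ξ : Plane) : ℂ :=
  𝓕 (fun y : Plane => (f y : ℂ)) ((2 * Real.pi)⁻¹ • ξ)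

/-- The Sobolev ball `H(β, C)`. -/
def sobolevBall (β C : ℝ) : Set (Plane → ℝ) :=
  {f | ∫⁻ ξ : Plane, ENNReal.ofReal ((1 + ‖ξ‖ ^ 2) ^ β * ‖fourierAngular f ξ‖ ^ 2)
    ≤ ENNReal.ofReal C}

/-- One observation `((t, s), Y)`: the line with direction angle `t` and signed distance `s`, and the
measured value `Y`. -/
abbrev Obs : Type := (ℝ × ℝ) × ℝ

/-- The uniform distribution on the cylinder `S¹ × [-1, 1]`, with `S¹` parametrized by the angle. -/
def design : Measure (ℝ × ℝ) :=
  ProbabilityTheory.cond volume (Ico 0 (2 * Real.pi) ×ˢ Icc (-1) 1)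

/-- The distribution `N(0, σ²)` of the noise. -/
def noise (σ : ℝ) : Measure ℝ := gaussianReal 0 (Real.toNNReal (σ ^ 2))

/-- The joint law of the i.i.d. design points and noise variables `((θ_i, s_i), ε_i)`, `i < n`. -/
def sampleLaw (σ : ℝ) (n : ℕ) : Measure (Fin n → (ℝ × ℝ) × ℝ) :=
  Measure.pi fun _ => design.prod (noise σ)

/-- The data `((θ_i, s_i), Y_i)` with `Y_i = T_μ f (θ_i, s_i) + ε_i`. -/
def observe (μ : ℝ) (f : Plane → ℝ) {n : ℕ} (ω : Fin n → (ℝ × ℝ) × ℝ) : Fin n → Obs :=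
  fun i => ((ω i).1, transform μ f (ω i).1.1 (ω i).1.2 + (ω i).2)

/-- The mean squared error `E_f (f̂(x) - f(x))²`, with values in `[0, ∞]`, of an estimator `est` of
`f(x)`, that is, a function of the data. -/
def risk (μ σ : ℝ) {n : ℕ} (est : (Fin n → Obs) → ℝ) (f : Plane → ℝ) (x : Plane) : ℝ≥0∞ :=
  ∫⁻ ω, ENNReal.ofReal ((est (observe μ f ω) - f x) ^ 2) ∂(sampleLaw σ n)

/-- The filter `K_δ`. -/
def filterK (μ δ s : ℝ) : ℝ :=
  1 / Real.pi * ∫ r in |μ|..√(1 / δ ^ 2 + μ ^ 2), r * Real.cos (s * r)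

/-- The kernel estimator of `f(x)` with bandwidth `δ`. -/
def kernelEst (μ : ℝ) (x : Plane) (δ : ℝ) {n : ℕ} (d : Fin n → Obs) : ℝ :=
  1 / (n : ℝ) * ∑ i, Real.exp (-(μ * inner ℝ x (perp (d i).1.1))) *
    filterK μ δ (inner ℝ x (dir (d i).1.1) - (d i).1.2) * (d i).2

/-- The grid `Δ_n` of bandwidths. -/
def grid (a : ℝ) (n : ℕ) : Set ℝ :=
  {δ | δ ∈ Icc (Real.log n / n) 1 ∧ ∃ j : ℕ, δ = a⁻¹ ^ j}

/-- `v(δ)`, where `v²(δ) = c₁ δ⁻³ / n`. -/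
def vOne (c₁ : ℝ) (n : ℕ) (δ : ℝ) : ℝ := √(c₁ * (δ ^ 3)⁻¹ / n)

/-- `v(δ, η)`, where `v²(δ, η) = (c₂ / n) ∫ (K_δ - K_η)²`. -/
def vTwo (μ c₂ : ℝ) (n : ℕ) (δ η : ℝ) : ℝ :=
  √(c₂ / n * ∫ u : ℝ, (filterK μ δ u - filterK μ η u) ^ 2)

/-- `λ(δ) = max (1, √(D log (1/δ)))`. -/
def lam (D δ : ℝ) : ℝ := max 1 √(D * Real.log (1 / δ))

/-- The threshold `ψ(δ, η) = v(δ) λ(δ) + v(δ, η) λ(η)`. -/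
def threshold (μ c₁ c₂ D : ℝ) (n : ℕ) (δ η : ℝ) : ℝ :=
  vOne c₁ n δ * lam D δ + vTwo μ c₂ n δ η * lam D η

/-- The data-driven bandwidth: the largest `δ` in the grid such that the kernel estimators at `δ` and
at every `η ≤ δ` of the grid differ by at most `ψ(δ, η)`. (For `n ≥ 2` the grid is finite and its
smallest element qualifies, so that the supremum is a maximum.) -/
def adaptiveBandwidth (μ c₁ c₂ D a : ℝ) (x : Plane) {n : ℕ} (d : Fin n → Obs) : ℝ :=
  sSup {δ | δ ∈ grid a n ∧ ∀ η ∈ grid a n, η ≤ δ →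
    |kernelEst μ x δ d - kernelEst μ x η d| ≤ threshold μ c₁ c₂ D n δ η}

/-- The adaptive estimator `f*(x)`. -/
def adaptiveEst (μ c₁ c₂ D a : ℝ) (x : Plane) {n : ℕ} (d : Fin n → Obs) : ℝ :=
  kernelEst μ x (adaptiveBandwidth μ c₁ c₂ D a x d) d

end ERT

end

/-!
The proof is Lepski's argument, and it rests on three facts about the kernel estimators.

*Bias.* The mean of `f̄_δ(x)` is `(4π²)⁻¹ ∫_{‖ξ‖ < 1/δ} e^{i x·ξ} f̃(ξ) dξ`
(`integral_weight_mul_transform_eq_freqPart`). Indeed, in the variable `ρ = √(r² - μ²)` the integral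
of `e^{-μ z·θ^⊥} cos(r z·θ)` over the directions `θ` equals that of `cos(ρ z·θ)`, because the
contour of integration of an entire periodic function can be shifted (`integral_exp_mul_cos`); so
the weights add up to the kernel whose Fourier transform is the indicator function of a disc. By
Fourier inversion at the continuity point `x`, the bias is the integral over the remaining
frequencies, and `f ∈ H(β, C)` with `β > 1` makes it at most a multiple of `δ ^ (β - 1)`
(`abs_bias_le`).

*Size of the filters.* `∫ K_δ²` is at most of order `δ⁻³`, and `∫ (K_δ - K_η)²` is at least of order
`η⁻³` when `η ≤ δ / 2`, hence for any two distinct points of the grid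
(`integrable_filterK_sq`, `le_integral_filterK_sub_sq`).

*Stochastic error.* A bound for exponential moments (`mgf_centeredAvg_le`) shows that the stochastic
error has the fourth moment of a Gaussian variable of variance `δ⁻³ / n`, and that the stochastic
error of `f̄_δ - f̄_η` exceeds `v(δ, η) λ(η)` with probability at most `2 η⁹`
(`IsDensity.measure_deviation_le`). The second bound needs `D` large and `n η ≥ log n`, which is
what the lower end of the grid provides.

The oracle bandwidth `δ*` is the grid point next to a small multiple of `(log n / n)^(1/(2β+1))`; up
to it the bias is dominated by `v(δ) λ(δ)` (`bias_le_threshold`). If the selected bandwidth is at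
least `δ*`, it has been compared with `δ*`, and the error is at most that of `f̄_{δ*}` plus a
threshold. If it is a smaller point `δ`, then the next larger grid point has been rejected, although
its bias is harmless; this has probability of order `δ⁸`, which outweighs the growth of the
stochastic error as `δ` decreases, and the sum over all such `δ` is of order `1 / n`
(`sq_error_le`, `IsDensity.risk_le`). The exponents `9` and `8` do not depend on `β`, which is why
`D` can be chosen without knowledge of it.

Functions of `B(L)` need not be Borel measurable. They are replaced by a Borel version
(`IsDensity`), which changes neither the Fourier transform nor, almost surely, the data.
-/

noncomputable section

namespace ERT

variable {L : ℝ} {f g : Plane → ℝ}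

/-! ### Orthogonal and polar coordinates, and the Bessel identity -/

lemma inner_dir (z : Plane) (t : ℝ) :
    inner ℝ z (dir t) = z 0 * Real.cos t + z 1 * Real.sin t := by
  simp [dir, PiLp.inner_apply, Fin.sum_univ_two, mul_comm]

lemma inner_perp (z : Plane) (t : ℝ) :
    inner ℝ z (perp t) = -(z 0 * Real.sin t) + z 1 * Real.cos t := by
  simp [perp, PiLp.inner_apply, Fin.sum_univ_two, mul_comm]

lemma norm_dir (t : ℝ) : ‖dir t‖ = 1 := by
  simp [dir, EuclideanSpace.norm_eq, Fin.sum_univ_two]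

lemma norm_perp (t : ℝ) : ‖perp t‖ = 1 := by
  simp [perp, EuclideanSpace.norm_eq, Fin.sum_univ_two]

@[fun_prop]
lemma continuous_dir : Continuous dir := by
  unfold dir
  refine (PiLp.continuous_toLp 2 _).comp (continuous_pi fun i => ?_)
  fin_cases i <;> simp <;> fun_prop

@[fun_prop]
lemma continuous_perp : Continuous perp := by
  unfold perp
  refine (PiLp.continuous_toLp 2 _).comp (continuous_pi fun i => ?_)
  fin_cases i <;> simp <;> fun_prop

/-- The orthogonal coordinates `(s, u) ↦ s θ + u θ^⊥` of the plane. -/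
def frame (t : ℝ) (p : ℝ × ℝ) : Plane := p.1 • dir t + p.2 • perp t

lemma frame_zero_coord (t : ℝ) (p : ℝ × ℝ) :
    frame t p 0 = p.1 * Real.cos t - p.2 * Real.sin t := by
  simp [frame, dir, perp]; ring

lemma frame_one_coord (t : ℝ) (p : ℝ × ℝ) :
    frame t p 1 = p.1 * Real.sin t + p.2 * Real.cos t := by
  simp [frame, dir, perp]

lemma inner_frame_dir (t : ℝ) (p : ℝ × ℝ) : inner ℝ (frame t p) (dir t) = p.1 := by
  rw [inner_dir, frame_zero_coord, frame_one_coord]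
  linear_combination p.1 * Real.cos_sq_add_sin_sq t

lemma inner_frame_perp (t : ℝ) (p : ℝ × ℝ) : inner ℝ (frame t p) (perp t) = p.2 := by
  rw [inner_perp, frame_zero_coord, frame_one_coord]
  linear_combination p.2 * Real.cos_sq_add_sin_sq t

lemma norm_frame_sq (t : ℝ) (p : ℝ × ℝ) : ‖frame t p‖ ^ 2 = p.1 ^ 2 + p.2 ^ 2 := by
  rw [EuclideanSpace.norm_sq_eq, Fin.sum_univ_two, Real.norm_eq_abs, Real.norm_eq_abs, sq_abs,
    sq_abs, frame_zero_coord, frame_one_coord]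
  linear_combination (p.1 ^ 2 + p.2 ^ 2) * Real.cos_sq_add_sin_sq t

lemma frame_zero_eq (p : ℝ × ℝ) : frame 0 p = !₂[p.1, p.2] := by
  ext i; fin_cases i <;> simp [frame, dir, perp]

lemma measurePreserving_frame_zero :
    MeasurePreserving (frame 0) (volume : Measure (ℝ × ℝ)) (volume : Measure Plane) := by
  have h := (PiLp.volume_preserving_toLp (Fin 2)).comp
    ((volume_preserving_finTwoArrow ℝ).symm MeasurableEquiv.finTwoArrow)
  have e : frame 0 = WithLp.toLp 2 ∘ MeasurableEquiv.finTwoArrow.symm := by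
    funext p
    rw [frame_zero_eq]
    rfl
  rw [e]
  exact h

/-- Rotation by the angle `t`. -/
def rotation (t : ℝ) : Plane →ₗᵢ[ℝ] Plane where
  toFun y := frame t (y 0, y 1)
  map_add' y z := by
    ext i; fin_cases i <;> simp [frame, dir, perp] <;> ring
  map_smul' c y := by
    ext i; fin_cases i <;> simp [frame, dir, perp] <;> ring
  norm_map' y := by
    have h : ‖frame t (y 0, y 1)‖ ^ 2 = ‖y‖ ^ 2 := by
      rw [norm_frame_sq, EuclideanSpace.norm_sq_eq, Fin.sum_univ_two]
      simp
    exact (pow_left_inj₀ (norm_nonneg _) (norm_nonneg _) two_ne_zero).1 h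

lemma measurePreserving_frame (t : ℝ) :
    MeasurePreserving (frame t) (volume : Measure (ℝ × ℝ)) (volume : Measure Plane) := by
  have h := ((rotation t).toLinearIsometryEquiv rfl).measurePreserving.comp
    measurePreserving_frame_zero
  have e : frame t = (rotation t).toLinearIsometryEquiv rfl ∘ frame 0 := by
    funext p
    simp [rotation, frame_zero_eq]
  rw [e]
  exact h

lemma continuous_frame : Continuous fun q : ℝ × (ℝ × ℝ) => frame q.1 q.2 := by
  unfold frame
  fun_prop

lemma frame_eq_of_inner (t : ℝ) (y : Plane) :
    frame t (inner ℝ y (dir t), inner ℝ y (perp t)) = y := by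
  ext i
  fin_cases i
  · simp only [Fin.zero_eta, frame_zero_coord, inner_dir, inner_perp]
    linear_combination y 0 * Real.cos_sq_add_sin_sq t
  · simp only [Fin.mk_one, frame_one_coord, inner_dir, inner_perp]
    linear_combination y 1 * Real.cos_sq_add_sin_sq t

lemma measurableEmbedding_frame (t : ℝ) : MeasurableEmbedding (frame t) := by
  have hc : Continuous (frame t) := by unfold frame; fun_prop
  let e : (ℝ × ℝ) ≃ᵐ Plane :=
    { toFun := frame t
      invFun := fun y => (inner ℝ y (dir t), inner ℝ y (perp t))
      left_inv := fun p => by simp [inner_frame_dir, inner_frame_perp]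
      right_inv := frame_eq_of_inner t
      measurable_toFun := hc.measurable
      measurable_invFun := by
        have : Continuous fun y : Plane => (inner ℝ y (dir t), inner ℝ y (perp t)) := by
          fun_prop
        exact this.measurable }
  exact e.measurableEmbedding

/-- Integration over the plane in polar coordinates. -/
lemma integral_polar (F : Plane → ℝ) :
    ∫ ξ : Plane, F ξ = ∫ p in Ioi (0 : ℝ) ×ˢ Ioo (-Real.pi) Real.pi, p.1 * F (p.1 • dir p.2) := by
  have h := integral_comp_polarCoord_symm (fun p : ℝ × ℝ => F (frame 0 p))
  rw [measurePreserving_frame_zero.integral_comp] at h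
  · rw [← h, polarCoord_target]
    refine integral_congr_ae (Eventually.of_forall fun p => ?_)
    simp only [smul_eq_mul]
    congr 2
    ext i; fin_cases i <;> simp [frame, dir, perp, polarCoord_symm_apply]
  · exact measurableEmbedding_frame 0

/-- The contour of integration of an entire `2π`-periodic function over a period can be shifted
vertically. -/
lemma integral_period_shift (F : ℂ → ℂ) (hF : Differentiable ℂ F)
    (hper : ∀ ζ, F (ζ + 2 * Real.pi) = F ζ) (c : ℝ) :
    ∫ t in (0 : ℝ)..2 * Real.pi, F (t + c * Complex.I) = ∫ t in (0 : ℝ)..2 * Real.pi, F t := by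
  have h := Complex.integral_boundary_rect_eq_zero_of_differentiableOn F 0
    (((2 * Real.pi : ℝ) : ℂ) + c * Complex.I) hF.differentiableOn
  simp only [Complex.zero_re, Complex.zero_im, Complex.add_re, Complex.ofReal_re, Complex.mul_re,
    Complex.I_re, Complex.ofReal_im, Complex.I_im, Complex.add_im, Complex.mul_im, mul_zero,
    zero_mul, sub_zero, add_zero, zero_add, mul_one, Complex.ofReal_zero] at h
  have h2 : ∀ y : ℝ, F (((2 * Real.pi : ℝ) : ℂ) + y * Complex.I) = F (y * Complex.I) := fun y => by
    rw [← hper (y * Complex.I)]; congr 1; push_cast; ring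
  simp only [h2] at h
  rw [add_sub_cancel_right, sub_eq_zero] at h
  exact h.symm

/-- The identity behind the inversion of the transform: both sides are `2π J₀(ρ |z|)`, the left one
after a shift of the contour by `arsinh (μ / ρ)`. -/
lemma integral_exp_mul_cos (μ ρ : ℝ) (hρ : 0 < ρ) (z : Plane) :
    ∫ t in (0 : ℝ)..2 * Real.pi, Real.exp (-(μ * inner ℝ z (perp t))) *
        Real.cos (√(ρ ^ 2 + μ ^ 2) * inner ℝ z (dir t)) =
      ∫ t in (0 : ℝ)..2 * Real.pi, Real.cos (ρ * inner ℝ z (dir t)) := by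
  set F : ℂ → ℂ := fun ζ =>
    Complex.exp (Complex.I * ρ * (z 0 * Complex.cos ζ + z 1 * Complex.sin ζ)) with hF
  have hd : Differentiable ℂ F := by fun_prop
  have hp : ∀ ζ, F (ζ + 2 * Real.pi) = F ζ := fun ζ => by
    simp only [hF, Complex.cos_add_two_pi, Complex.sin_add_two_pi]
  have key := integral_period_shift F hd hp (Real.arsinh (μ / ρ))
  have hch : ρ * Real.cosh (Real.arsinh (μ / ρ)) = √(ρ ^ 2 + μ ^ 2) := by
    rw [Real.cosh_arsinh, ← Real.sqrt_sq hρ.le, ← Real.sqrt_mul (sq_nonneg _), Real.sqrt_sq hρ.le]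
    congr 1; field_simp
  have hsh : ρ * Real.sinh (Real.arsinh (μ / ρ)) = μ := by
    rw [Real.sinh_arsinh]; field_simp
  set c := Real.arsinh (μ / ρ)
  have hre : ∀ (G : ℝ → ℂ), Continuous G → (∫ t in (0 : ℝ)..2 * Real.pi, G t).re =
      ∫ t in (0 : ℝ)..2 * Real.pi, (G t).re := fun G hG => by
    have := Complex.reCLM.intervalIntegral_comp_comm
      (hG.intervalIntegrable (μ := volume) 0 (2 * Real.pi))
    simpa using this.symm
  have hFc := hd.continuous
  have k2 := congrArg Complex.re key
  rw [hre _ (by fun_prop), hre _ (by fun_prop)] at k2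
  have e1 : ∀ t : ℝ, (F (t + c * Complex.I)).re = Real.exp (-(μ * inner ℝ z (perp t))) *
        Real.cos (√(ρ ^ 2 + μ ^ 2) * inner ℝ z (dir t)) := fun t => by
    have : Complex.I * ρ * (z 0 * Complex.cos (t + c * Complex.I) +
        z 1 * Complex.sin (t + c * Complex.I)) =
        ((-(μ * inner ℝ z (perp t)) : ℝ) : ℂ) +
          ((√(ρ ^ 2 + μ ^ 2) * inner ℝ z (dir t) : ℝ) : ℂ) * Complex.I := by
      rw [Complex.cos_add, Complex.sin_add, Complex.cos_mul_I, Complex.sin_mul_I, ← hch]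
      rw [show -(μ * inner ℝ z (perp t)) = -(ρ * Real.sinh c * inner ℝ z (perp t)) by rw [hsh]]
      rw [inner_dir, inner_perp]
      push_cast
      ring_nf
      simp only [Complex.I_sq]
      ring
    simp only [hF]
    rw [this, Complex.exp_re]
    simp
  have e2 : ∀ t : ℝ, (F t).re = Real.cos (ρ * inner ℝ z (dir t)) := fun t => by
    have : Complex.I * ρ * (z 0 * Complex.cos t + z 1 * Complex.sin t) =
        ((ρ * inner ℝ z (dir t) : ℝ) : ℂ) * Complex.I := by
      rw [inner_dir]; push_cast; ring
    simp only [hF]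
    rw [this, Complex.exp_ofReal_mul_I_re]
  simpa only [e1, e2] using k2

/-- The filter in the radial variable `ρ` with `r² = ρ² + μ²`. -/
lemma filterK_eq (μ δ s : ℝ) (hδ : 0 < δ) :
    filterK μ δ s = 1 / Real.pi * ∫ ρ in (0 : ℝ)..1 / δ, ρ * Real.cos (s * √(ρ ^ 2 + μ ^ 2)) := by
  have h0 : (0 : ℝ) ≤ 1 / δ := by positivity
  unfold filterK
  congr 1
  have h := intervalIntegral.integral_comp_mul_deriv''' (a := 0) (b := 1 / δ)
    (f := fun ρ : ℝ => √(ρ ^ 2 + μ ^ 2)) (f' := fun ρ => ρ / √(ρ ^ 2 + μ ^ 2))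
    (g := fun r => r * Real.cos (s * r)) (by fun_prop) ?_ (by fun_prop) ?_ ?_
  · simp only [Function.comp_def] at h
    rw [show √(1 / δ ^ 2 + μ ^ 2) = √((1 / δ) ^ 2 + μ ^ 2) by rw [one_div_pow],
      show |μ| = √((0 : ℝ) ^ 2 + μ ^ 2) by rw [zero_pow two_ne_zero, zero_add, Real.sqrt_sq_eq_abs],
      ← h]
    refine intervalIntegral.integral_congr fun ρ _ => ?_
    rcases eq_or_ne (√(ρ ^ 2 + μ ^ 2)) 0 with h1 | h1
    · have : ρ = 0 := by
        rw [Real.sqrt_eq_zero (by positivity)] at h1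
        nlinarith [sq_nonneg ρ, sq_nonneg μ]
      simp [this]
    · field_simp
  · intro ρ hρ
    have : 0 < ρ := by
      have := hρ.1
      rwa [min_eq_left h0] at this
    have hd : HasDerivAt (fun ρ : ℝ => ρ ^ 2 + μ ^ 2) (2 * ρ) ρ := by
      simpa using (hasDerivAt_pow 2 ρ).add_const (μ ^ 2)
    exact ((hd.sqrt (by positivity)).hasDerivWithinAt (s := Ioi ρ)).congr_deriv
      (mul_div_mul_left _ _ two_ne_zero)
  · refine ContinuousOn.integrableOn_compact ?_ (by fun_prop)
    exact (isCompact_uIcc).image_of_continuousOn (by fun_prop)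
  · have : IntegrableOn (fun ρ : ℝ => ρ * Real.cos (s * √(ρ ^ 2 + μ ^ 2))) (uIcc 0 (1 / δ)) :=
      ContinuousOn.integrableOn_compact isCompact_uIcc (by fun_prop)
    refine this.congr (Eventually.of_forall fun ρ => ?_)
    simp only [Function.comp_def]
    rcases eq_or_ne (√(ρ ^ 2 + μ ^ 2)) 0 with h1 | h1
    · have : ρ = 0 := by
        rw [Real.sqrt_eq_zero (by positivity)] at h1
        nlinarith [sq_nonneg ρ, sq_nonneg μ]
      simp [this]
    · field_simp

/-! ### The mean of the kernel estimator as a convolution -/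

/-- The weight of the observation at the line `p = (t, s)` in the kernel estimator. -/
def weight (μ : ℝ) (x : Plane) (δ : ℝ) (p : ℝ × ℝ) : ℝ :=
  Real.exp (-(μ * inner ℝ x (perp p.1))) * filterK μ δ (inner ℝ x (dir p.1) - p.2)

lemma continuous_filterK (μ : ℝ) {δ : ℝ} : Continuous (filterK μ δ) := by
  unfold filterK
  refine continuous_const.mul ?_
  exact intervalIntegral.continuous_parametric_intervalIntegral_of_continuous' (by fun_prop) _ _

lemma continuous_weight (μ : ℝ) (x : Plane) {δ : ℝ} : Continuous (weight μ x δ) := by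
  have := continuous_filterK μ (δ := δ)
  unfold weight
  fun_prop

lemma abs_filterK_le (μ : ℝ) {δ : ℝ} (hδ : 0 < δ) (s : ℝ) : |filterK μ δ s| ≤ (δ ^ 2)⁻¹ := by
  rw [filterK_eq μ δ s hδ, abs_mul]
  have h0 : (0 : ℝ) ≤ 1 / δ := by positivity
  have h : ‖∫ ρ in (0 : ℝ)..1 / δ, ρ * Real.cos (s * √(ρ ^ 2 + μ ^ 2))‖ ≤
      1 / δ * |1 / δ - 0| := by
    refine intervalIntegral.norm_integral_le_of_norm_le_const fun ρ hρ => ?_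
    rw [uIoc_of_le h0] at hρ
    rw [norm_mul, Real.norm_eq_abs, Real.norm_eq_abs, abs_of_pos hρ.1]
    exact (mul_le_of_le_one_right hρ.1.le (Real.abs_cos_le_one _)).trans hρ.2
  rw [sub_zero, abs_of_nonneg h0, Real.norm_eq_abs] at h
  have h1 : |1 / Real.pi| ≤ 1 := by
    rw [abs_of_pos (by positivity)]
    exact (div_le_one Real.pi_pos).2 (by linarith [Real.pi_gt_three])
  calc _ ≤ 1 * (1 / δ * (1 / δ)) := by gcongr
    _ = _ := by field_simp

lemma abs_inner_perp_le (z : Plane) (t : ℝ) : |inner ℝ z (perp t)| ≤ ‖z‖ := by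
  simpa [norm_perp] using abs_real_inner_le_norm z (perp t)

lemma exp_inner_perp_le (μ : ℝ) (z : Plane) (t : ℝ) :
    Real.exp (-(μ * inner ℝ z (perp t))) ≤ Real.exp (|μ| * ‖z‖) := by
  refine Real.exp_le_exp.2 ((neg_le_abs _).trans ?_)
  rw [abs_mul]
  gcongr
  exact abs_inner_perp_le z t

/-- Borel measurable functions bounded by `L` and supported in the closed unit disc. -/
structure IsDensity (L : ℝ) (g : Plane → ℝ) : Prop where
  measurable : Measurable g
  bound : ∀ y, |g y| ≤ L
  support : ∀ y, 1 < ‖y‖ → g y = 0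

lemma IsDensity.integrable (hg : IsDensity L g) : Integrable g := by
  have h : IntegrableOn g (Metric.closedBall 0 1) := by
    refine Measure.integrableOn_of_bounded (M := L) ?_ hg.measurable.aestronglyMeasurable
      (Eventually.of_forall hg.bound)
    exact (isCompact_closedBall (0 : Plane) 1).measure_lt_top.ne
  refine (integrableOn_iff_integrable_of_support_subset fun y hy => ?_).1 h
  by_contra hc
  exact hy (hg.support y (by simpa using hc))

lemma IsDensity.frame_eq_zero (hg : IsDensity L g) {t s u : ℝ} (h : 1 < |s| ∨ 1 < |u|) :
    g (s • dir t + u • perp t) = 0 := by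
  refine hg.support _ ?_
  have h1 : ‖s • dir t + u • perp t‖ ^ 2 = s ^ 2 + u ^ 2 := norm_frame_sq t (s, u)
  have h2 : 1 < s ^ 2 + u ^ 2 := by
    rcases h with h | h
    · nlinarith [sq_abs s, sq_nonneg u]
    · nlinarith [sq_abs u, sq_nonneg s]
  rw [← h1] at h2
  exact (one_lt_sq_iff₀ (norm_nonneg _)).1 h2

lemma IsDensity.transform_eq_zero (hg : IsDensity L g) (μ : ℝ) {t s : ℝ} (h : 1 < |s|) :
    transform μ g t s = 0 := by
  simp [transform, hg.frame_eq_zero (Or.inl h)]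

/-- The contribution of the direction `t` to the mean of the kernel estimator. -/
lemma setIntegral_weight_mul_transform (hg : IsDensity L g) (μ : ℝ) (x : Plane) {δ : ℝ}
    (hδ : 0 < δ) (t : ℝ) :
    ∫ s in Icc (-1 : ℝ) 1, weight μ x δ (t, s) * transform μ g t s =
      ∫ y, Real.exp (-(μ * inner ℝ (x - y) (perp t))) * filterK μ δ (inner ℝ (x - y) (dir t)) *
        g y := by
  have hK := continuous_filterK μ (δ := δ)
  set H : Plane → ℝ := fun y => Real.exp (-(μ * inner ℝ (x - y) (perp t))) *
    filterK μ δ (inner ℝ (x - y) (dir t)) * g y with hH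
  have hHint : Integrable H := by
    refine (hg.integrable.norm.const_mul (Real.exp (|μ| * (‖x‖ + 1)) * (δ ^ 2)⁻¹)).mono' ?_ ?_
    · have : Continuous fun y : Plane => Real.exp (-(μ * inner ℝ (x - y) (perp t))) *
        filterK μ δ (inner ℝ (x - y) (dir t)) := by fun_prop
      exact (this.measurable.mul hg.measurable).aestronglyMeasurable
    · refine Eventually.of_forall fun y => ?_
      rcases lt_or_ge 1 ‖y‖ with hy | hy
      · simp [hH, hg.support y hy]
      · rw [norm_mul, norm_mul, Real.norm_eq_abs, Real.abs_exp, Real.norm_eq_abs]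
        have h1 : ‖x - y‖ ≤ ‖x‖ + 1 := (norm_sub_le x y).trans (by linarith)
        have h2 : Real.exp (-(μ * inner ℝ (x - y) (perp t))) ≤ Real.exp (|μ| * (‖x‖ + 1)) :=
          (exp_inner_perp_le μ (x - y) t).trans (Real.exp_le_exp.2 (by gcongr))
        have h3 := abs_filterK_le μ hδ (inner ℝ (x - y) (dir t))
        exact mul_le_mul_of_nonneg_right (mul_le_mul h2 h3 (abs_nonneg _) (Real.exp_pos _).le)
          (norm_nonneg _)
  rw [← (measurePreserving_frame t).integral_comp (measurableEmbedding_frame t) H]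
  have hint2 : Integrable (fun p => H (frame t p)) (volume : Measure (ℝ × ℝ)) :=
    (measurePreserving_frame t).integrable_comp_of_integrable hHint
  rw [Measure.volume_eq_prod] at hint2 ⊢
  rw [integral_prod _ hint2]
  rw [setIntegral_eq_integral_of_forall_compl_eq_zero]
  · refine integral_congr_ae (Eventually.of_forall fun s => ?_)
    simp only [transform]
    rw [← integral_const_mul]
    refine integral_congr_ae (Eventually.of_forall fun u => ?_)
    simp only [hH, weight, inner_sub_left, inner_frame_dir, inner_frame_perp]
    rw [show -(μ * (inner ℝ x (perp t) - u)) = -(μ * inner ℝ x (perp t)) + μ * u by ring,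
      Real.exp_add]
    simp only [frame]
    ring
  · intro s hs
    rw [hg.transform_eq_zero, mul_zero]
    by_contra hc
    exact hs (abs_le.1 (not_lt.1 hc))

/-- The weights of the estimator, integrated over all directions, give the kernel whose Fourier
transform is the indicator function of the ball of radius `1 / δ`. -/
lemma integral_exp_mul_filterK (μ : ℝ) {δ : ℝ} (hδ : 0 < δ) (z : Plane) :
    ∫ t in (0 : ℝ)..2 * Real.pi, Real.exp (-(μ * inner ℝ z (perp t))) *
        filterK μ δ (inner ℝ z (dir t)) =
      1 / Real.pi * ∫ ξ in Metric.ball (0 : Plane) (1 / δ), Real.cos (inner ℝ z ξ) := by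
  have h0 : (0 : ℝ) ≤ 1 / δ := by positivity
  have hpi := Real.pi_pos
  -- both sides equal the integral in polar coordinates
  have hL : ∫ t in (0 : ℝ)..2 * Real.pi, Real.exp (-(μ * inner ℝ z (perp t))) *
        filterK μ δ (inner ℝ z (dir t)) =
      1 / Real.pi * ∫ ρ in (0 : ℝ)..1 / δ, ∫ t in (0 : ℝ)..2 * Real.pi,
        ρ * Real.cos (ρ * inner ℝ z (dir t)) := by
    have e : ∀ t, Real.exp (-(μ * inner ℝ z (perp t))) * filterK μ δ (inner ℝ z (dir t)) =
        1 / Real.pi * ∫ ρ in (0 : ℝ)..1 / δ, ρ * (Real.exp (-(μ * inner ℝ z (perp t))) *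
          Real.cos (√(ρ ^ 2 + μ ^ 2) * inner ℝ z (dir t))) := fun t => by
      rw [filterK_eq μ δ _ hδ, mul_left_comm, ← intervalIntegral.integral_const_mul]
      congr 1
      refine intervalIntegral.integral_congr fun ρ _ => ?_
      rw [mul_comm (inner ℝ z (dir t))]
      ring
    simp only [e]
    rw [intervalIntegral.integral_const_mul]
    congr 1
    rw [intervalIntegral_intervalIntegral_swap]
    · refine intervalIntegral.integral_congr_ae (Eventually.of_forall fun ρ hρ => ?_)
      rw [uIoc_of_le h0] at hρ
      rw [intervalIntegral.integral_const_mul, intervalIntegral.integral_const_mul,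
        integral_exp_mul_cos μ ρ hρ.1 z]
    · refine IntegrableOn.mono_set (t := uIcc 0 (2 * Real.pi) ×ˢ uIcc 0 (1 / δ)) ?_
        (prod_mono uIoc_subset_uIcc uIoc_subset_uIcc)
      refine ContinuousOn.integrableOn_compact (isCompact_uIcc.prod isCompact_uIcc) ?_
      unfold Function.uncurry
      fun_prop
  have hR : ∫ ξ in Metric.ball (0 : Plane) (1 / δ), Real.cos (inner ℝ z ξ) =
      ∫ ρ in (0 : ℝ)..1 / δ, ∫ t in (0 : ℝ)..2 * Real.pi,
        ρ * Real.cos (ρ * inner ℝ z (dir t)) := by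
    rw [← integral_indicator Metric.isOpen_ball.measurableSet, integral_polar]
    have e : ∀ p ∈ Ioi (0 : ℝ) ×ˢ Ioo (-Real.pi) Real.pi,
        p.1 * (Metric.ball (0 : Plane) (1 / δ)).indicator (fun ξ => Real.cos (inner ℝ z ξ))
          (p.1 • dir p.2) =
        (Iio (1 / δ) ×ˢ univ).indicator
          (fun p : ℝ × ℝ => p.1 * Real.cos (p.1 * inner ℝ z (dir p.2))) p := by
      rintro ⟨ρ, t⟩ hp
      have hρ : 0 < ρ := hp.1
      have hn : ‖ρ • dir t‖ = ρ := by rw [norm_smul, norm_dir, Real.norm_of_nonneg hρ.le, mul_one]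
      by_cases h : ρ < 1 / δ
      · rw [indicator_of_mem, indicator_of_mem, inner_smul_right]
        · exact ⟨h, mem_univ _⟩
        · simpa [hn] using h
      · rw [indicator_of_notMem, indicator_of_notMem, mul_zero]
        · exact fun hc => h hc.1
        · simpa [hn] using h
    rw [setIntegral_congr_fun (measurableSet_Ioi.prod measurableSet_Ioo) e,
      setIntegral_indicator (measurableSet_Iio.prod MeasurableSet.univ), prod_inter_prod,
      inter_univ, Ioi_inter_Iio, Measure.volume_eq_prod, setIntegral_prod]
    · rw [intervalIntegral.integral_of_le h0, integral_Ioc_eq_integral_Ioo]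
      refine integral_congr_ae (Eventually.of_forall fun ρ => ?_)
      simp only
      have hper : Function.Periodic (fun t => ρ * Real.cos (ρ * inner ℝ z (dir t)))
          (2 * Real.pi) := fun t => by simp [dir]
      have := hper.intervalIntegral_add_eq 0 (-Real.pi)
      rw [zero_add] at this
      rw [this, intervalIntegral.integral_of_le (by linarith), integral_Ioc_eq_integral_Ioo]
      congr 3
      ring
    · rw [← Measure.volume_eq_prod]
      refine IntegrableOn.mono_set (t := Icc 0 (1 / δ) ×ˢ Icc (-Real.pi) Real.pi) ?_
        (prod_mono Ioo_subset_Icc_self Ioo_subset_Icc_self)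
      exact ContinuousOn.integrableOn_compact (isCompact_Icc.prod isCompact_Icc) (by fun_prop)
  rw [hL, hR]

lemma design_eq : design = ENNReal.ofReal (1 / (4 * Real.pi)) •
    (volume.restrict (Ico 0 (2 * Real.pi))).prod (volume.restrict (Icc (-1 : ℝ) 1)) := by
  have hpi := Real.pi_pos
  unfold design ProbabilityTheory.cond
  rw [Measure.prod_restrict, ← Measure.volume_eq_prod, Measure.volume_eq_prod, Measure.prod_prod,
    Real.volume_Ico, Real.volume_Icc, ← ENNReal.ofReal_mul (by linarith),
    ← ENNReal.ofReal_inv_of_pos (by linarith)]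
  congr 2
  field_simp
  ring

instance : IsProbabilityMeasure design := by
  have hpi := Real.pi_pos
  refine cond_isProbabilityMeasure_of_finite ?_ ?_
  · rw [Measure.volume_eq_prod, Measure.prod_prod, Real.volume_Ico, Real.volume_Icc,
      ← ENNReal.ofReal_mul (by linarith)]
    simp; linarith
  · rw [Measure.volume_eq_prod, Measure.prod_prod, Real.volume_Ico, Real.volume_Icc,
      ← ENNReal.ofReal_mul (by linarith)]
    exact ENNReal.ofReal_ne_top

lemma IsDensity.measurable_transform (hg : IsDensity L g) (μ : ℝ) :
    Measurable fun p : ℝ × ℝ => transform μ g p.1 p.2 := by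
  have h : Measurable fun q : (ℝ × ℝ) × ℝ =>
      Real.exp (μ * q.2) * g (q.1.2 • dir q.1.1 + q.2 • perp q.1.1) := by
    have h1 : Continuous fun q : (ℝ × ℝ) × ℝ => q.1.2 • dir q.1.1 + q.2 • perp q.1.1 := by
      fun_prop
    exact (by fun_prop : Measurable fun q : (ℝ × ℝ) × ℝ => Real.exp (μ * q.2)).mul
      (hg.measurable.comp h1.measurable)
  exact h.stronglyMeasurable.integral_prod_right'.measurable

lemma IsDensity.abs_transform_le (hg : IsDensity L g) (μ t s : ℝ) :
    |transform μ g t s| ≤ Real.exp |μ| * L * 2 := by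
  have hL : 0 ≤ L := (abs_nonneg _).trans (hg.bound 0)
  have e : transform μ g t s =
      ∫ u in Icc (-1 : ℝ) 1, Real.exp (μ * u) * g (s • dir t + u • perp t) := by
    unfold transform
    rw [setIntegral_eq_integral_of_forall_compl_eq_zero]
    intro u hu
    rw [hg.frame_eq_zero, mul_zero]
    right
    by_contra hc
    exact hu (abs_le.1 (not_lt.1 hc))
  rw [e, ← Real.norm_eq_abs]
  refine (norm_setIntegral_le_of_norm_le_const (C := Real.exp |μ| * L) (by simp) ?_).trans ?_
  · intro u hu
    rw [norm_mul, Real.norm_eq_abs, Real.abs_exp]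
    have h1 : μ * u ≤ |μ| := (le_abs_self _).trans (by
      rw [abs_mul]; exact mul_le_of_le_one_right (abs_nonneg _) (abs_le.2 hu))
    exact mul_le_mul (Real.exp_le_exp.2 h1) (hg.bound _) (norm_nonneg _) (Real.exp_pos _).le
  · simp [Measure.real]
    norm_num

lemma abs_weight_le (μ : ℝ) (x : Plane) {δ : ℝ} (hδ : 0 < δ) (p : ℝ × ℝ) :
    |weight μ x δ p| ≤ Real.exp (|μ| * ‖x‖) * (δ ^ 2)⁻¹ := by
  rw [weight, abs_mul, Real.abs_exp]
  exact mul_le_mul (exp_inner_perp_le μ x _) (abs_filterK_le μ hδ _) (abs_nonneg _)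
    (Real.exp_pos _).le

/-- The mean of a summand of the kernel estimator. -/
lemma integral_weight_mul_transform (hg : IsDensity L g) (μ : ℝ) (x : Plane) {δ : ℝ}
    (hδ : 0 < δ) :
    ∫ p, weight μ x δ p * transform μ g p.1 p.2 ∂design =
      1 / (4 * Real.pi ^ 2) *
        ∫ y, g y * ∫ ξ in Metric.ball (0 : Plane) (1 / δ), Real.cos (inner ℝ (x - y) ξ) := by
  have hpi := Real.pi_pos
  have hK := continuous_filterK μ (δ := δ)
  have hint : Integrable (fun p : ℝ × ℝ => weight μ x δ p * transform μ g p.1 p.2)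
      ((volume.restrict (Ico 0 (2 * Real.pi))).prod (volume.restrict (Icc (-1 : ℝ) 1))) := by
    refine Integrable.of_bound (C := Real.exp (|μ| * ‖x‖) * (δ ^ 2)⁻¹ * (Real.exp |μ| * L * 2))
      ((continuous_weight μ x).measurable.mul
        (hg.measurable_transform μ)).aestronglyMeasurable (Eventually.of_forall fun p => ?_)
    rw [norm_mul]
    exact mul_le_mul (abs_weight_le μ x hδ p) (hg.abs_transform_le μ _ _) (norm_nonneg _)
      (by positivity)
  rw [design_eq, integral_smul_measure, integral_prod _ hint,
    ENNReal.toReal_ofReal (by positivity)]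
  simp only [setIntegral_weight_mul_transform hg μ x hδ]
  rw [integral_Ico_eq_integral_Ioc, ← intervalIntegral.integral_of_le (by linarith),
    intervalIntegral_integral_swap]
  · have e : ∀ y, ∫ t in (0 : ℝ)..2 * Real.pi, Real.exp (-(μ * inner ℝ (x - y) (perp t))) *
        filterK μ δ (inner ℝ (x - y) (dir t)) * g y =
        1 / Real.pi * (g y *
          ∫ ξ in Metric.ball (0 : Plane) (1 / δ), Real.cos (inner ℝ (x - y) ξ)) := fun y => by
      rw [intervalIntegral.integral_mul_const, integral_exp_mul_filterK μ hδ]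
      ring
    simp only [e]
    rw [integral_const_mul, smul_eq_mul, ← mul_assoc]
    congr 1
    field_simp
  · have : IsFiniteMeasure (volume.restrict (uIoc 0 (2 * Real.pi))) := by
      rw [uIoc_of_le (by linarith)]
      infer_instance
    have hgi : Integrable (fun p : ℝ × Plane => ‖g p.2‖)
        ((volume.restrict (uIoc 0 (2 * Real.pi))).prod volume) :=
      hg.integrable.norm.comp_snd _
    refine (hgi.const_mul (Real.exp (|μ| * (‖x‖ + 1)) * (δ ^ 2)⁻¹)).mono' ?_ ?_
    · have : Continuous fun p : ℝ × Plane => Real.exp (-(μ * inner ℝ (x - p.2) (perp p.1))) *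
        filterK μ δ (inner ℝ (x - p.2) (dir p.1)) := by fun_prop
      exact (this.measurable.mul (hg.measurable.comp measurable_snd)).aestronglyMeasurable
    · refine Eventually.of_forall fun p => ?_
      simp only [Function.uncurry]
      rcases lt_or_ge 1 ‖p.2‖ with hy | hy
      · simp [hg.support p.2 hy]
      · rw [norm_mul, norm_mul, Real.norm_eq_abs, Real.abs_exp, Real.norm_eq_abs]
        have h1 : ‖x - p.2‖ ≤ ‖x‖ + 1 := (norm_sub_le x p.2).trans (by linarith)
        have h2 : Real.exp (-(μ * inner ℝ (x - p.2) (perp p.1))) ≤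
            Real.exp (|μ| * (‖x‖ + 1)) :=
          (exp_inner_perp_le μ (x - p.2) p.1).trans (Real.exp_le_exp.2 (by gcongr))
        have h3 := abs_filterK_le μ hδ (inner ℝ (x - p.2) (dir p.1))
        exact mul_le_mul_of_nonneg_right (mul_le_mul h2 h3 (abs_nonneg _) (Real.exp_pos _).le)
          (norm_nonneg _)

/-! ### The bias of the kernel estimator on a Sobolev ball -/

/-- A function of `classB L` is continuous on the Borel set of its continuity points, which has full
measure, so that it has a Borel version. -/
lemma exists_isDensity (hf : f ∈ classB L) : ∃ g, IsDensity L g ∧ f =ᵐ[volume] g := by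
  obtain ⟨hsupp, hcont, hbd⟩ := hf
  have hL : 0 ≤ L := (abs_nonneg _).trans (hbd 0)
  have hmeas : AEStronglyMeasurable f volume := by
    have hS : MeasurableSet {y | ContinuousAt f y} :=
      (IsGδ.setOfPred_continuousAt f).measurableSet
    have h1 : ContinuousOn f {y | ContinuousAt f y} := fun y hy => hy.continuousWithinAt
    have h2 := h1.aestronglyMeasurable (μ := volume) hS
    have h3 : (volume : Measure Plane).restrict {y | ContinuousAt f y} = volume :=
      Measure.restrict_eq_self_of_ae_mem hcont
    rwa [h3] at h2
  refine ⟨(Metric.closedBall (0 : Plane) 1).indicator fun y => max (-L) (min L (hmeas.mk f y)),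
    ⟨?_, ?_, ?_⟩, ?_⟩
  · exact (measurable_const.max (measurable_const.min
      hmeas.stronglyMeasurable_mk.measurable)).indicator Metric.isClosed_closedBall.measurableSet
  · intro y
    by_cases hy : y ∈ Metric.closedBall (0 : Plane) 1
    · rw [indicator_of_mem hy, abs_le]
      exact ⟨le_max_left _ _, max_le (by linarith) (min_le_left _ _)⟩
    · rw [indicator_of_notMem hy, abs_zero]
      exact hL
  · intro y hy
    exact indicator_of_notMem (by simpa using hy) _
  · filter_upwards [hmeas.ae_eq_mk] with y hy
    by_cases hy1 : y ∈ Metric.closedBall (0 : Plane) 1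
    · rw [indicator_of_mem hy1, ← hy, min_eq_right (abs_le.1 (hbd y)).2,
        max_eq_right (abs_le.1 (hbd y)).1]
    · rw [indicator_of_notMem hy1]
      exact hsupp y (by simpa using hy1)

/-- The transforms of almost everywhere equal functions agree at almost every line. -/
lemma transform_ae_eq (h : f =ᵐ[volume] g) (μ : ℝ) :
    ∀ᵐ p ∂design, transform μ f p.1 p.2 = transform μ g p.1 p.2 := by
  have hac : design ≪ (volume : Measure ℝ).prod volume := by
    rw [design_eq, Measure.prod_restrict]
    exact Measure.smul_absolutelyContinuous.trans Measure.absolutelyContinuous_restrict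
  refine hac.ae_le ?_
  obtain ⟨N, hN, hNm, hN0⟩ := exists_measurable_superset_of_null (ae_iff.1 h)
  have hassoc : ∀ᵐ q ∂((volume : Measure ℝ).prod ((volume : Measure ℝ).prod (volume : Measure ℝ))),
      frame q.1 q.2 ∉ N := by
    rw [ae_iff]
    simp only [not_not]
    have hm : MeasurableSet {q : ℝ × (ℝ × ℝ) | frame q.1 q.2 ∈ N} :=
      continuous_frame.measurable hNm
    refine (Measure.measure_prod_null hm).2 (Eventually.of_forall fun t => ?_)
    have := (measurePreserving_frame t).measure_preimage hNm.nullMeasurableSet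
    rw [hN0, Measure.volume_eq_prod] at this
    exact this
  have h3 : ∀ᵐ q ∂(((volume : Measure ℝ).prod (volume : Measure ℝ)).prod (volume : Measure ℝ)),
      frame q.1.1 (q.1.2, q.2) ∉ N := by
    exact (measurePreserving_prodAssoc volume volume volume).quasiMeasurePreserving.ae hassoc
  filter_upwards [Measure.ae_ae_of_ae_prod h3] with p hp
  refine integral_congr_ae ?_
  filter_upwards [hp] with u hu
  have : f (frame p.1 (p.2, u)) = g (frame p.1 (p.2, u)) := by
    by_contra hc
    exact hu (hN hc)
  simp only [frame] at this
  rw [this]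

lemma fourierAngular_eq (f : Plane → ℝ) (ξ : Plane) :
    fourierAngular f ξ = ∫ y, Complex.exp (((-inner ℝ y ξ : ℝ) : ℂ) * Complex.I) * f y := by
  rw [fourierAngular, Real.fourier_eq']
  refine integral_congr_ae (Eventually.of_forall fun y => ?_)
  simp only [smul_eq_mul, inner_smul_right]
  congr 4
  field_simp

lemma continuous_fourierAngular (hf : Integrable f) : Continuous (fourierAngular f) := by
  simp only [funext (fourierAngular_eq f)]
  refine continuous_of_dominated (bound := fun y => ‖f y‖) (fun ξ => ?_) (fun ξ => ?_) hf.norm ?_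
  · have : Continuous fun y : Plane => Complex.exp (((-inner ℝ y ξ : ℝ) : ℂ) * Complex.I) := by
      fun_prop
    exact this.aestronglyMeasurable.mul hf.ofReal.aestronglyMeasurable
  · refine Eventually.of_forall fun y => ?_
    rw [norm_mul, Complex.norm_exp_ofReal_mul_I, one_mul, Complex.norm_real]
  · refine Eventually.of_forall fun y => ?_
    fun_prop

/-- The real part of `e^{i x·ξ} f̃(ξ)`, the contribution of the frequency `ξ` to `f x`. -/
def freqPart (f : Plane → ℝ) (x ξ : Plane) : ℝ :=
  (Complex.exp (((inner ℝ x ξ : ℝ) : ℂ) * Complex.I) * fourierAngular f ξ).re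

lemma abs_freqPart_le (f : Plane → ℝ) (x ξ : Plane) :
    |freqPart f x ξ| ≤ ‖fourierAngular f ξ‖ := by
  refine (Complex.abs_re_le_norm _).trans ?_
  rw [norm_mul, Complex.norm_exp_ofReal_mul_I, one_mul]

lemma continuous_freqPart (hf : Integrable f) (x : Plane) : Continuous (freqPart f x) := by
  have := continuous_fourierAngular hf
  unfold freqPart
  fun_prop

lemma freqPart_eq (hf : Integrable f) (x ξ : Plane) :
    freqPart f x ξ = ∫ y, f y * Real.cos (inner ℝ (x - y) ξ) := by
  rw [freqPart, fourierAngular_eq, ← integral_const_mul]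
  have h : ∀ y : Plane, Complex.exp (((inner ℝ x ξ : ℝ) : ℂ) * Complex.I) *
      (Complex.exp (((-inner ℝ y ξ : ℝ) : ℂ) * Complex.I) * f y) =
      Complex.exp (((inner ℝ (x - y) ξ : ℝ) : ℂ) * Complex.I) * f y := fun y => by
    rw [← mul_assoc, ← Complex.exp_add, inner_sub_left]
    congr 2
    push_cast
    ring
  simp only [h]
  have hint : Integrable fun y : Plane =>
      Complex.exp (((inner ℝ (x - y) ξ : ℝ) : ℂ) * Complex.I) * f y := by
    refine (hf.ofReal (𝕜 := ℂ)).mono ?_ (Eventually.of_forall fun y => ?_)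
    · have : Continuous fun y : Plane =>
        Complex.exp (((inner ℝ (x - y) ξ : ℝ) : ℂ) * Complex.I) := by fun_prop
      exact this.aestronglyMeasurable.mul hf.ofReal.aestronglyMeasurable
    · rw [norm_mul, Complex.norm_exp_ofReal_mul_I, one_mul]
      simp
  have := integral_re hint
  simp only [RCLike.re_eq_complex_re] at this
  rw [← this]
  refine integral_congr_ae (Eventually.of_forall fun y => ?_)
  simp only [Complex.mul_re, Complex.exp_ofReal_mul_I_re, Complex.ofReal_re, Complex.ofReal_im,
    mul_zero, sub_zero]
  ring

/-- The mean of the kernel estimator truncates the Fourier integral at the radius `1 / δ`. -/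
lemma integral_weight_mul_transform_eq_freqPart (hg : IsDensity L g) (μ : ℝ) (x : Plane) {δ : ℝ}
    (hδ : 0 < δ) :
    ∫ p, weight μ x δ p * transform μ g p.1 p.2 ∂design =
      1 / (4 * Real.pi ^ 2) * ∫ ξ in Metric.ball (0 : Plane) (1 / δ), freqPart g x ξ := by
  rw [integral_weight_mul_transform hg μ x hδ]
  congr 1
  simp only [freqPart_eq hg.integrable, ← integral_const_mul]
  rw [integral_integral_swap]
  have : IsFiniteMeasure ((volume : Measure Plane).restrict (Metric.ball 0 (1 / δ))) :=
    ⟨by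
      rw [Measure.restrict_apply_univ]
      exact measure_ball_lt_top⟩
  have h1 : Integrable (fun p : Plane × Plane => ‖g p.1‖)
      ((volume : Measure Plane).prod ((volume : Measure Plane).restrict (Metric.ball 0 (1 / δ)))) :=
    hg.integrable.norm.comp_fst _
  refine h1.mono' ?_ (Eventually.of_forall fun p => ?_)
  · have : Continuous fun p : Plane × Plane => Real.cos (inner ℝ (x - p.1) p.2) := by fun_prop
    exact ((hg.measurable.comp measurable_fst).mul this.measurable).aestronglyMeasurable
  · simp only [Function.uncurry, norm_mul]
    exact mul_le_of_le_one_right (norm_nonneg _) (Real.abs_cos_le_one _)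

lemma integral_freqPart_of_continuousAt (hf : Integrable f) (hF : Integrable (fourierAngular f))
    {x : Plane} (hx : ContinuousAt f x) :
    f x = 1 / (4 * Real.pi ^ 2) * ∫ ξ, freqPart f x ξ := by
  have hpi := Real.pi_pos
  have hF' : Integrable (𝓕 (fun y : Plane => (f y : ℂ))) := by
    refine (integrable_comp_smul_iff volume _ (R := (2 * Real.pi)⁻¹) (by positivity)).1 ?_
    exact hF
  have h := (hf.ofReal (𝕜 := ℂ)).fourierInv_fourier_eq hF' (v := x)
    (Complex.continuous_ofReal.continuousAt.comp hx)
  rw [Real.fourierInv_eq'] at h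
  have h2 := Measure.integral_comp_smul (volume : Measure Plane) (fun v : Plane =>
    Complex.exp (((2 * Real.pi * inner ℝ v x : ℝ) : ℂ) * Complex.I) •
      𝓕 (fun y : Plane => (f y : ℂ)) v) (2 * Real.pi)⁻¹
  have hint : Integrable fun ξ : Plane =>
      Complex.exp (((inner ℝ x ξ : ℝ) : ℂ) * Complex.I) * fourierAngular f ξ := by
    refine hF.mono ?_ (Eventually.of_forall fun ξ => ?_)
    · have : Continuous fun ξ : Plane =>
        Complex.exp (((inner ℝ x ξ : ℝ) : ℂ) * Complex.I) := by fun_prop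
      exact this.aestronglyMeasurable.mul hF.aestronglyMeasurable
    · rw [norm_mul, Complex.norm_exp_ofReal_mul_I, one_mul]
  have h3 := integral_re hint
  simp only [RCLike.re_eq_complex_re] at h3
  have e : ∀ ξ : Plane, Complex.exp (((2 * Real.pi * inner ℝ ((2 * Real.pi)⁻¹ • ξ) x : ℝ) : ℂ) *
      Complex.I) • 𝓕 (fun y : Plane => (f y : ℂ)) ((2 * Real.pi)⁻¹ • ξ) =
      Complex.exp (((inner ℝ x ξ : ℝ) : ℂ) * Complex.I) * fourierAngular f ξ := fun ξ => by
    rw [smul_eq_mul, fourierAngular, real_inner_smul_left, real_inner_comm]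
    congr 4
    field_simp
  simp only [e] at h2
  erw [h] at h2
  unfold freqPart
  rw [h3, h2, finrank_euclideanSpace_fin, abs_of_pos (by positivity), Complex.smul_re]
  change f x = 1 / (4 * Real.pi ^ 2) * (((2 * Real.pi)⁻¹ ^ 2)⁻¹ * f x)
  field_simp
  norm_num

/-- The integral of `‖ξ‖ ^ (-2β)` over the complement of the open unit ball. -/
def tailMass (β : ℝ) : ℝ := ∫ ξ in (Metric.ball (0 : Plane) 1)ᶜ, ‖ξ‖ ^ (-(2 * β))

lemma integrable_tail {β : ℝ} (hβ : 1 < β) :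
    IntegrableOn (fun ξ : Plane => ‖ξ‖ ^ (-(2 * β))) (Metric.ball (0 : Plane) 1)ᶜ := by
  have h := (integrable_one_add_norm (E := Plane) (μ := volume) (r := 2 * β)
    (by rw [finrank_euclideanSpace_fin]; push_cast; linarith)).const_mul (2 ^ (2 * β))
  refine (h.integrableOn (s := (Metric.ball (0 : Plane) 1)ᶜ)).mono' ?_ ?_
  · exact (measurable_norm.pow_const _).aestronglyMeasurable
  · refine (ae_restrict_iff' Metric.isOpen_ball.measurableSet.compl).2
      (Eventually.of_forall fun ξ hξ => ?_)
    have h1 : 1 ≤ ‖ξ‖ := by simpa using hξ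
    have h2 : 0 < ‖ξ‖ := by linarith
    rw [Real.norm_eq_abs, abs_of_nonneg (by positivity), Real.rpow_neg h2.le,
      Real.rpow_neg (by positivity), ← div_eq_mul_inv, ← one_div,
      div_le_div_iff₀ (by positivity) (by positivity), one_mul,
      ← Real.mul_rpow (by norm_num) h2.le]
    exact Real.rpow_le_rpow (by positivity) (by linarith) (by linarith)

lemma tail_scaling {β R : ℝ} (hβ : 1 < β) (hR : 0 < R) :
    IntegrableOn (fun ξ : Plane => ‖ξ‖ ^ (-(2 * β))) (Metric.ball (0 : Plane) R)ᶜ ∧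
    ∫ ξ in (Metric.ball (0 : Plane) R)ᶜ, ‖ξ‖ ^ (-(2 * β)) =
      R ^ (2 - 2 * β) * tailMass β := by
  set G : Plane → ℝ := (Metric.ball (0 : Plane) R)ᶜ.indicator fun ξ => ‖ξ‖ ^ (-(2 * β)) with hG
  have hm : ∀ r : ℝ, MeasurableSet (Metric.ball (0 : Plane) r)ᶜ := fun r =>
    Metric.isOpen_ball.measurableSet.compl
  have e : ∀ ξ, G (R • ξ) = R ^ (-(2 * β)) *
      (Metric.ball (0 : Plane) 1)ᶜ.indicator (fun ξ => ‖ξ‖ ^ (-(2 * β))) ξ := fun ξ => by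
    have hn : ‖R • ξ‖ = R * ‖ξ‖ := by rw [norm_smul, Real.norm_of_nonneg hR.le]
    have hiff : R • ξ ∈ (Metric.ball (0 : Plane) R)ᶜ ↔ ξ ∈ (Metric.ball (0 : Plane) 1)ᶜ := by
      simp only [mem_compl_iff, mem_ball_zero_iff, hn, not_lt]
      exact le_mul_iff_one_le_right hR
    by_cases h : ξ ∈ (Metric.ball (0 : Plane) 1)ᶜ
    · rw [hG, indicator_of_mem (hiff.2 h), indicator_of_mem h, hn, Real.mul_rpow hR.le
        (norm_nonneg _)]
    · rw [hG, indicator_of_notMem (fun hc => h (hiff.1 hc)), indicator_of_notMem h, mul_zero]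
  constructor
  · rw [← integrable_indicator_iff (hm R), ← integrable_comp_smul_iff volume _ hR.ne']
    change Integrable (fun ξ => G (R • ξ)) volume
    simp only [e]
    exact ((integrable_indicator_iff (hm 1)).2 (integrable_tail hβ)).const_mul _
  · have h := Measure.integral_comp_smul (volume : Measure Plane) G R
    simp only [e] at h
    rw [integral_const_mul, integral_indicator (hm 1), integral_indicator (hm R),
      finrank_euclideanSpace_fin, abs_of_pos (by positivity), smul_eq_mul] at h
    change R ^ (-(2 * β)) * tailMass β = _ at h
    rw [show (2 : ℝ) - 2 * β = 2 + -(2 * β) by ring, Real.rpow_add hR, mul_assoc, h,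
      Real.rpow_two, ← mul_assoc, mul_inv_cancel₀ (by positivity), one_mul]

lemma tailMass_nonneg (β : ℝ) : 0 ≤ tailMass β :=
  integral_nonneg fun ξ => by positivity

lemma sobolev_integrable {β C : ℝ} (hC : 0 < C) (hf : f ∈ sobolevBall β C)
    (hfi : Integrable f) :
    Integrable (fun ξ : Plane => (1 + ‖ξ‖ ^ 2) ^ β * ‖fourierAngular f ξ‖ ^ 2) ∧
      ∫ ξ : Plane, (1 + ‖ξ‖ ^ 2) ^ β * ‖fourierAngular f ξ‖ ^ 2 ≤ C := by
  have hc := continuous_fourierAngular hfi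
  have hm : AEStronglyMeasurable (fun ξ : Plane => (1 + ‖ξ‖ ^ 2) ^ β * ‖fourierAngular f ξ‖ ^ 2)
      volume := by
    have h1 : Measurable fun ξ : Plane => (1 + ‖ξ‖ ^ 2) ^ β :=
      (by fun_prop : Measurable fun ξ : Plane => 1 + ‖ξ‖ ^ 2).pow_const _
    exact (h1.mul (hc.norm.pow 2).measurable).aestronglyMeasurable
  have h0 : ∀ ξ : Plane, 0 ≤ (1 + ‖ξ‖ ^ 2) ^ β * ‖fourierAngular f ξ‖ ^ 2 := fun ξ => by
    positivity
  have hi := (lintegral_ofReal_ne_top_iff_integrable hm (Eventually.of_forall h0)).1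
    (ne_top_of_le_ne_top ENNReal.ofReal_ne_top hf)
  refine ⟨hi, ?_⟩
  have := ofReal_integral_eq_lintegral_ofReal hi (Eventually.of_forall h0)
  have h2 : ENNReal.ofReal _ ≤ _ := this.trans_le hf
  exact (ENNReal.ofReal_le_ofReal_iff hC.le).1 h2

/-- Weighted arithmetic-geometric mean inequality that separates the Sobolev norm. -/
lemma norm_le_weighted {w F τ : ℝ} (hw : 0 < w) (hτ : 0 < τ) :
    F ≤ (τ * w⁻¹ + τ⁻¹ * (w * F ^ 2)) := by
  have h : 0 ≤ (τ - w * F) ^ 2 := sq_nonneg _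
  have e : τ * w⁻¹ + τ⁻¹ * (w * F ^ 2) = (τ ^ 2 + (w * F) ^ 2) / (τ * w) := by field_simp
  rw [e, le_div_iff₀ (by positivity)]
  nlinarith [sq_nonneg (τ + w * F)]

lemma integrable_fourierAngular {β C : ℝ} (hβ : 1 < β) (hC : 0 < C) (hf : f ∈ sobolevBall β C)
    (hfi : Integrable f) : Integrable (fourierAngular f) := by
  have h1 := (integrable_rpow_neg_one_add_norm_sq (E := Plane) (μ := volume) (r := 2 * β)
    (by rw [finrank_euclideanSpace_fin]; push_cast; linarith))
  refine (h1.add (sobolev_integrable hC hf hfi).1).mono'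
    (continuous_fourierAngular hfi).aestronglyMeasurable (Eventually.of_forall fun ξ => ?_)
  have hw : (0 : ℝ) < (1 + ‖ξ‖ ^ 2) ^ β := by positivity
  refine (norm_le_weighted hw one_pos).trans (le_of_eq ?_)
  simp only [Pi.add_apply, one_mul, inv_one]
  rw [← Real.rpow_neg (by positivity)]
  congr 2
  ring

/-- The bias constant of the Sobolev ball `sobolevBall β C`. -/
def biasConst (β C : ℝ) : ℝ := tailMass β + C

/-- The bias of the kernel estimator with bandwidth `δ` is of order `δ ^ (β - 1)`. -/
lemma abs_bias_le {β C : ℝ} (hβ : 1 < β) (hC : 0 < C) (hf : f ∈ sobolevBall β C)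
    (hg : IsDensity L g) (hfg : f =ᵐ[volume] g) {x : Plane}
    (hx : ContinuousAt f x) (μ : ℝ) {δ : ℝ} (hδ : 0 < δ) :
    |∫ p, weight μ x δ p * transform μ g p.1 p.2 ∂design - f x| ≤
      biasConst β C * δ ^ (β - 1) := by
  have hpi := Real.pi_pos
  have hfi : Integrable f := hg.integrable.congr hfg.symm
  have hF := integrable_fourierAngular hβ hC hf hfi
  have hfr : ∀ ξ, freqPart g x ξ = freqPart f x ξ := fun ξ => by
    rw [freqPart_eq hg.integrable, freqPart_eq hfi]
    refine integral_congr_ae ?_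
    filter_upwards [hfg] with y hy
    rw [hy]
  have hfrint : Integrable (freqPart f x) :=
    hF.norm.mono' (continuous_freqPart hfi x).aestronglyMeasurable
      (Eventually.of_forall fun ξ => abs_freqPart_le f x ξ)
  rw [integral_weight_mul_transform_eq_freqPart hg μ x hδ,
    integral_freqPart_of_continuousAt hfi hF hx]
  simp only [hfr]
  rw [← integral_add_compl (Metric.isOpen_ball.measurableSet (s := Metric.ball (0 : Plane) (1 / δ)))
    hfrint, mul_add, sub_add_cancel_left, abs_neg, abs_mul]
  set S := (Metric.ball (0 : Plane) (1 / δ))ᶜ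
  obtain ⟨hsi, hsC⟩ := sobolev_integrable hC hf hfi
  have hR : 0 < 1 / δ := by positivity
  obtain ⟨hti, hte⟩ := tail_scaling hβ hR
  -- this `τ` balances the tail of `‖ξ‖ ^ (-2β)`, of order `δ ^ (2β - 2)`, against the Sobolev norm
  set τ := (1 / δ) ^ (β - 1) with hτ
  have hτ0 : 0 < τ := by positivity
  have h1 : |∫ ξ in S, freqPart f x ξ| ≤
      ∫ ξ in S, (τ * ‖ξ‖ ^ (-(2 * β)) +
        τ⁻¹ * ((1 + ‖ξ‖ ^ 2) ^ β * ‖fourierAngular f ξ‖ ^ 2)) := by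
    refine (norm_integral_le_integral_norm (freqPart f x)).trans ?_
    refine setIntegral_mono_on hfrint.norm.integrableOn
      ((hti.const_mul _).add (hsi.const_mul _).integrableOn)
      Metric.isOpen_ball.measurableSet.compl fun ξ hξ => ?_
    have hξ1 : 1 / δ ≤ ‖ξ‖ := by simpa [S] using hξ
    have hξ0 : 0 < ‖ξ‖ := hR.trans_le hξ1
    have hw : (0 : ℝ) < (1 + ‖ξ‖ ^ 2) ^ β := by positivity
    refine (abs_freqPart_le f x ξ).trans
      ((norm_le_weighted hw hτ0).trans ?_)
    gcongr
    rw [Real.rpow_neg hξ0.le, Real.rpow_mul hξ0.le, Real.rpow_two]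
    gcongr
    linarith
  have h2 : ∫ ξ in S, (τ * ‖ξ‖ ^ (-(2 * β)) +
        τ⁻¹ * ((1 + ‖ξ‖ ^ 2) ^ β * ‖fourierAngular f ξ‖ ^ 2)) ≤
      τ * ((1 / δ) ^ (2 - 2 * β) * tailMass β) + τ⁻¹ * C := by
    rw [integral_add (hti.const_mul _) (hsi.const_mul _).integrableOn, integral_const_mul,
      integral_const_mul, hte]
    gcongr
    exact (setIntegral_le_integral hsi (Eventually.of_forall fun ξ => by positivity)).trans hsC
  have h3 : τ * ((1 / δ) ^ (2 - 2 * β) * tailMass β) + τ⁻¹ * C =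
      biasConst β C * δ ^ (β - 1) := by
    have e1 : τ⁻¹ = δ ^ (β - 1) := by
      rw [hτ, one_div, Real.inv_rpow hδ.le, inv_inv]
    have e2 : τ * (1 / δ) ^ (2 - 2 * β) = τ⁻¹ := by
      rw [hτ, ← Real.rpow_add hR, ← Real.rpow_neg hR.le]
      congr 1
      ring
    rw [← mul_assoc, e2, e1, biasConst]
    ring
  have h4 : |1 / (4 * Real.pi ^ 2)| ≤ 1 := by
    rw [abs_of_pos (by positivity), div_le_one (by positivity)]
    nlinarith [Real.pi_gt_three]
  calc _ ≤ 1 * (biasConst β C * δ ^ (β - 1)) :=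
        mul_le_mul h4 ((h1.trans h2).trans_eq h3) (abs_nonneg _) zero_le_one
    _ = _ := one_mul _

/-! ### Energy estimates for the filters -/

/-- `√(1 + μ²)`, the ratio by which the outer frequency of the filter may exceed `1 / δ`. -/
def freqRatio (μ : ℝ) : ℝ := √(1 + μ ^ 2)

lemma one_le_freqRatio (μ : ℝ) : 1 ≤ freqRatio μ :=
  Real.one_le_sqrt.2 (by nlinarith [sq_nonneg μ])

lemma freqRatio_sq (μ : ℝ) : freqRatio μ ^ 2 = 1 + μ ^ 2 := Real.sq_sqrt (by positivity)

lemma sqrt_freq_le (μ : ℝ) {δ ρ : ℝ} (hδ : 0 < δ) (hδ1 : δ ≤ 1) (hρ0 : 0 ≤ ρ) (hρ : ρ ≤ 1 / δ) :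
    √(ρ ^ 2 + μ ^ 2) ≤ freqRatio μ / δ := by
  refine Real.sqrt_le_iff.2 ⟨div_nonneg (Real.sqrt_nonneg _) hδ.le, ?_⟩
  rw [div_pow, freqRatio_sq, add_div]
  have h1 : ρ ^ 2 ≤ (1 / δ) ^ 2 := by gcongr
  have h2 : μ ^ 2 ≤ μ ^ 2 / δ ^ 2 := by
    rw [le_div_iff₀ (by positivity)]
    exact mul_le_of_le_one_right (sq_nonneg _) (pow_le_one₀ hδ.le hδ1)
  rw [one_div_pow] at h1
  linarith

lemma integral_mul_cos {u a b : ℝ} (hu : u ≠ 0) :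
    ∫ r in a..b, r * Real.cos (u * r) =
      (b * Real.sin (u * b) - a * Real.sin (u * a)) / u +
        (Real.cos (u * b) - Real.cos (u * a)) / u ^ 2 := by
  have hd : ∀ r : ℝ, HasDerivAt
      (fun r => r * Real.sin (u * r) / u + Real.cos (u * r) / u ^ 2) (r * Real.cos (u * r)) r := by
    intro r
    have h0 : HasDerivAt (fun r : ℝ => u * r) u r := by simpa using (hasDerivAt_id r).const_mul u
    have h1 := (((hasDerivAt_id r).mul h0.sin).div_const u).add (h0.cos.div_const (u ^ 2))
    refine h1.congr_deriv ?_
    simp only [id]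
    field_simp
    ring
  rw [intervalIntegral.integral_eq_sub_of_hasDerivAt (fun r _ => hd r)
    ((by fun_prop : Continuous fun r : ℝ => r * Real.cos (u * r)).intervalIntegrable _ _)]
  ring

lemma abs_integral_mul_cos_le {u a b : ℝ} (hu : u ≠ 0) (ha : 0 ≤ a) (hab : a ≤ b) :
    |∫ r in a..b, r * Real.cos (u * r)| ≤ 2 * b / |u| := by
  have hu' : 0 < |u| := abs_pos.2 hu
  rw [integral_mul_cos hu]
  have h1 : |(b * Real.sin (u * b) - a * Real.sin (u * a)) / u| ≤ (b + a) / |u| := by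
    rw [abs_div]
    gcongr
    refine (abs_sub _ _).trans ?_
    rw [abs_mul, abs_mul, abs_of_nonneg ha, abs_of_nonneg (ha.trans hab)]
    exact add_le_add (mul_le_of_le_one_right (ha.trans hab) (Real.abs_sin_le_one _))
      (mul_le_of_le_one_right ha (Real.abs_sin_le_one _))
  have h2 : |(Real.cos (u * b) - Real.cos (u * a)) / u ^ 2| ≤ (b - a) / |u| := by
    have hl : |Real.cos (u * b) - Real.cos (u * a)| ≤ |u| * (b - a) := by
      have := Real.abs_cos_sub_cos_le (u * b) (u * a)
      rwa [← mul_sub, abs_mul, abs_of_nonneg (sub_nonneg.2 hab)] at this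
    rw [abs_div, abs_pow, div_le_div_iff₀ (by positivity) hu']
    nlinarith
  calc _ ≤ (b + a) / |u| + (b - a) / |u| := (abs_add_le _ _).trans (add_le_add h1 h2)
    _ = _ := by ring

lemma filterK_sq_le (μ : ℝ) {δ : ℝ} (hδ : 0 < δ) (hδ1 : δ ≤ 1) (u : ℝ) :
    filterK μ δ u ^ 2 ≤ 2 * freqRatio μ ^ 2 * (δ ^ 4)⁻¹ * (1 + (δ⁻¹ * u) ^ 2)⁻¹ := by
  have hpi := Real.pi_gt_three
  have hf := one_le_freqRatio μ
  have h1 : filterK μ δ u ^ 2 ≤ (δ ^ 4)⁻¹ := by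
    have := pow_le_pow_left₀ (abs_nonneg _) (abs_filterK_le μ hδ u) 2
    rw [sq_abs] at this
    refine this.trans_eq ?_
    rw [← inv_pow, ← pow_mul, inv_pow]
  have h2 : filterK μ δ u ^ 2 * (δ⁻¹ * u) ^ 2 ≤ freqRatio μ ^ 2 * (δ ^ 4)⁻¹ := by
    rcases eq_or_ne u 0 with rfl | hu
    · simp; positivity
    have hu' : 0 < |u| := abs_pos.2 hu
    have hR : √(1 / δ ^ 2 + μ ^ 2) ≤ freqRatio μ / δ := by
      have := sqrt_freq_le μ hδ hδ1 (by positivity : 0 ≤ 1 / δ) le_rfl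
      rwa [one_div_pow] at this
    have hab : |μ| ≤ √(1 / δ ^ 2 + μ ^ 2) := by
      rw [← Real.sqrt_sq_eq_abs]
      exact Real.sqrt_le_sqrt (by have : 0 < 1 / δ ^ 2 := (by positivity); linarith)
    have h3 : |filterK μ δ u| ≤ freqRatio μ / δ / |u| := by
      rw [filterK, abs_mul, abs_of_pos (by positivity)]
      calc _ ≤ 1 / Real.pi * (2 * √(1 / δ ^ 2 + μ ^ 2) / |u|) := by
            gcongr
            exact abs_integral_mul_cos_le hu (abs_nonneg _) hab
        _ ≤ 1 / 3 * (3 * (freqRatio μ / δ) / |u|) := by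
            gcongr
            norm_num
        _ = _ := by ring
    have h4 := pow_le_pow_left₀ (abs_nonneg _) h3 2
    rw [sq_abs] at h4
    calc _ ≤ (freqRatio μ / δ / |u|) ^ 2 * (δ⁻¹ * u) ^ 2 := by gcongr
      _ = _ := by
        rw [div_pow _ |u|, sq_abs]
        field_simp
  rw [← div_eq_mul_inv, le_div_iff₀ (by positivity)]
  have h5 : (δ ^ 4)⁻¹ ≤ freqRatio μ ^ 2 * (δ ^ 4)⁻¹ :=
    le_mul_of_one_le_left (by positivity) (one_le_pow₀ hf)
  nlinarith

/-- The constant in the bound `∫ K_δ² ≤ const * δ⁻³`. -/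
def energyConst (μ : ℝ) : ℝ := 2 * freqRatio μ ^ 2 * Real.pi

lemma energyConst_pos (μ : ℝ) : 0 < energyConst μ := by
  have := one_le_freqRatio μ
  have := Real.pi_pos
  unfold energyConst
  positivity

lemma integrable_filterK_sq (μ : ℝ) {δ : ℝ} (hδ : 0 < δ) (hδ1 : δ ≤ 1) :
    Integrable (fun u => filterK μ δ u ^ 2) ∧
      ∫ u, filterK μ δ u ^ 2 ≤ energyConst μ * (δ ^ 3)⁻¹ := by
  have hi : Integrable fun u : ℝ => 2 * freqRatio μ ^ 2 * (δ ^ 4)⁻¹ * (1 + (δ⁻¹ * u) ^ 2)⁻¹ :=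
    (integrable_inv_one_add_sq.comp_mul_left' (inv_ne_zero hδ.ne')).const_mul _
  have hi2 : Integrable (fun u => filterK μ δ u ^ 2) := by
    refine hi.mono' ((continuous_filterK μ).pow 2).aestronglyMeasurable
      (Eventually.of_forall fun u => ?_)
    rw [Real.norm_of_nonneg (sq_nonneg _)]
    exact filterK_sq_le μ hδ hδ1 u
  refine ⟨hi2, (integral_mono hi2 hi fun u => filterK_sq_le μ hδ hδ1 u).trans_eq ?_⟩
  rw [integral_const_mul]
  have h := Measure.integral_comp_mul_left (fun v : ℝ => (1 + v ^ 2)⁻¹) δ⁻¹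
  rw [integral_univ_inv_one_add_sq, inv_inv, abs_of_pos hδ, smul_eq_mul] at h
  rw [h, energyConst]
  field_simp

lemma integrable_filterK_sub_sq (μ : ℝ) {δ η : ℝ} (hη : 0 < η) (hηδ : η ≤ δ) (hδ1 : δ ≤ 1) :
    Integrable (fun u => (filterK μ δ u - filterK μ η u) ^ 2) ∧
      ∫ u, (filterK μ δ u - filterK μ η u) ^ 2 ≤ 4 * energyConst μ * (η ^ 3)⁻¹ := by
  obtain ⟨i1, b1⟩ := integrable_filterK_sq μ (hη.trans_le hηδ) hδ1
  obtain ⟨i2, b2⟩ := integrable_filterK_sq μ hη (hηδ.trans hδ1)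
  have hp : ∀ u, (filterK μ δ u - filterK μ η u) ^ 2 ≤
      2 * filterK μ δ u ^ 2 + 2 * filterK μ η u ^ 2 := fun u => by
    nlinarith [sq_nonneg (filterK μ δ u + filterK μ η u)]
  have hi := (i1.const_mul 2).add (i2.const_mul 2)
  have hi2 : Integrable (fun u => (filterK μ δ u - filterK μ η u) ^ 2) := by
    refine hi.mono' (((continuous_filterK μ).sub (continuous_filterK μ)).pow 2).aestronglyMeasurable
      (Eventually.of_forall fun u => ?_)
    rw [Real.norm_of_nonneg (sq_nonneg _)]
    exact hp u
  refine ⟨hi2, (integral_mono hi2 hi hp).trans ?_⟩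
  simp only [Pi.add_apply]
  rw [integral_add (i1.const_mul 2) (i2.const_mul 2), integral_const_mul, integral_const_mul]
  have h3 : (δ ^ 3)⁻¹ ≤ (η ^ 3)⁻¹ := by gcongr
  have := mul_le_mul_of_nonneg_left h3 (energyConst_pos μ).le
  linarith

/-- For `η ≤ δ / 2` the filters `K_δ` and `K_η` differ by a multiple of `η⁻²` on an interval of
length of order `η`. -/
lemma le_integral_filterK_sub_sq (μ : ℝ) {δ η : ℝ} (hη : 0 < η) (hηδ : 2 * η ≤ δ) (hδ1 : δ ≤ 1) :
    (200 * freqRatio μ)⁻¹ * (η ^ 3)⁻¹ ≤ ∫ u, (filterK μ δ u - filterK μ η u) ^ 2 := by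
  have hpi := Real.pi_pos
  have hf := one_le_freqRatio μ
  have hδ : 0 < δ := by linarith
  obtain ⟨hi, -⟩ := integrable_filterK_sub_sq μ hη (by linarith) hδ1
  set h := η / freqRatio μ with hh
  have hh0 : 0 < h := by positivity
  have hδη : 1 / δ ≤ 1 / η := by gcongr; linarith
  have key : ∀ u ∈ Icc (-h) h, (η ^ 2)⁻¹ / 20 ≤ filterK μ η u - filterK μ δ u := by
    intro u hu
    have hc : ∀ c d : ℝ, IntervalIntegrable
        (fun ρ : ℝ => ρ * Real.cos (u * √(ρ ^ 2 + μ ^ 2))) volume c d := fun c d =>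
      (by fun_prop : Continuous fun ρ : ℝ => ρ * Real.cos (u * √(ρ ^ 2 + μ ^ 2))).intervalIntegrable
        _ _
    rw [filterK_eq μ η u hη, filterK_eq μ δ u hδ, ← mul_sub,
      intervalIntegral.integral_interval_sub_left (hc _ _) (hc _ _)]
    have h1 : ∫ ρ in 1 / δ..1 / η, ρ * (1 / 2 : ℝ) ≤
        ∫ ρ in 1 / δ..1 / η, ρ * Real.cos (u * √(ρ ^ 2 + μ ^ 2)) := by
      refine intervalIntegral.integral_mono_on hδη
        ((by fun_prop : Continuous fun ρ : ℝ => ρ * (1 / 2 : ℝ)).intervalIntegrable _ _) (hc _ _)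
        fun ρ hρ => ?_
      have hρ0 : 0 < ρ := lt_of_lt_of_le (by positivity) hρ.1
      refine mul_le_mul_of_nonneg_left ?_ hρ0.le
      have h2 : |u * √(ρ ^ 2 + μ ^ 2)| ≤ 1 := by
        rw [abs_mul, abs_of_nonneg (Real.sqrt_nonneg _)]
        calc _ ≤ h * (freqRatio μ / η) := mul_le_mul (abs_le.2 hu)
              (sqrt_freq_le μ hη (by linarith) hρ0.le hρ.2) (Real.sqrt_nonneg _) hh0.le
          _ = 1 := by rw [hh]; field_simp
      have h3 := Real.one_sub_sq_div_two_le_cos (x := u * √(ρ ^ 2 + μ ^ 2))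
      have h4 := (sq_le_one_iff_abs_le_one _).2 h2
      linarith
    have h5 : ∫ ρ in 1 / δ..1 / η, ρ * (1 / 2 : ℝ) = ((η ^ 2)⁻¹ - (δ ^ 2)⁻¹) / 4 := by
      rw [intervalIntegral.integral_mul_const, integral_id, one_div_pow, one_div_pow]
      ring
    have h6 : (δ ^ 2)⁻¹ ≤ (η ^ 2)⁻¹ / 4 := by
      rw [show (η ^ 2)⁻¹ / 4 = ((2 * η) ^ 2)⁻¹ by rw [mul_pow, mul_inv]; ring]
      gcongr
    have h7 : 0 < (η ^ 2)⁻¹ := by positivity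
    have h9 : (η ^ 2)⁻¹ * (3 / 16) ≤ ∫ ρ in 1 / δ..1 / η, ρ * Real.cos (u * √(ρ ^ 2 + μ ^ 2)) := by
      rw [h5] at h1
      linarith
    calc (η ^ 2)⁻¹ / 20 ≤ 1 / Real.pi * ((η ^ 2)⁻¹ * (3 / 16)) := by
          rw [div_mul_eq_mul_div, one_mul, div_le_div_iff₀ (by norm_num) hpi]
          nlinarith [Real.pi_lt_d2]
      _ ≤ _ := by gcongr
  have h10 : ∫ u in Icc (-h) h, ((η ^ 2)⁻¹ / 20) ^ 2 ≤
      ∫ u in Icc (-h) h, (filterK μ δ u - filterK μ η u) ^ 2 := by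
    refine setIntegral_mono_on (by simp) hi.integrableOn measurableSet_Icc fun u hu => ?_
    rw [← neg_sq (filterK μ δ u - _), neg_sub]
    have := key u hu
    gcongr
  refine le_trans (le_of_eq ?_) (h10.trans (setIntegral_le_integral hi
    (Eventually.of_forall fun u => sq_nonneg _)))
  rw [setIntegral_const, Real.volume_real_Icc_of_le (by linarith), hh, smul_eq_mul]
  field_simp
  norm_num

/-- The weight `e^{-μ x·θ^⊥} k(x·θ - s)` of a line for a general filter `k`. -/
def filterWeight (μ : ℝ) (x : Plane) (k : ℝ → ℝ) (p : ℝ × ℝ) : ℝ :=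
  Real.exp (-(μ * inner ℝ x (perp p.1))) * k (inner ℝ x (dir p.1) - p.2)

lemma weight_eq (μ : ℝ) (x : Plane) (δ : ℝ) :
    weight μ x δ = filterWeight μ x (filterK μ δ) := rfl

lemma weight_sub (μ : ℝ) (x : Plane) (δ η : ℝ) (p : ℝ × ℝ) :
    weight μ x δ p - weight μ x η p =
      filterWeight μ x (fun u => filterK μ δ u - filterK μ η u) p := by
  simp only [weight, filterWeight]
  ring

lemma continuous_filterWeight (μ : ℝ) (x : Plane) {k : ℝ → ℝ} (hk : Continuous k) :
    Continuous (filterWeight μ x k) := by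
  unfold filterWeight
  fun_prop

lemma integral_filterWeight_sq_le (μ : ℝ) (x : Plane) {k : ℝ → ℝ} (hk : Continuous k) {B : ℝ}
    (hB : ∀ u, |k u| ≤ B) (hi : Integrable fun u => k u ^ 2) :
    ∫ p, filterWeight μ x k p ^ 2 ∂design ≤ Real.exp (|μ| * ‖x‖) ^ 2 * ∫ u, k u ^ 2 := by
  have hpi := Real.pi_pos
  set W := Real.exp (|μ| * ‖x‖)
  have hc := continuous_filterWeight μ x hk
  have hint : Integrable (fun p : ℝ × ℝ => filterWeight μ x k p ^ 2)
      ((volume.restrict (Ico 0 (2 * Real.pi))).prod (volume.restrict (Icc (-1 : ℝ) 1))) := by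
    refine Integrable.of_bound (C := (W * B) ^ 2) (hc.pow 2).aestronglyMeasurable
      (Eventually.of_forall fun p => ?_)
    rw [Real.norm_of_nonneg (sq_nonneg _), ← sq_abs]
    gcongr
    rw [filterWeight, abs_mul, Real.abs_exp]
    exact mul_le_mul (exp_inner_perp_le μ x _) (hB _) (abs_nonneg _) (Real.exp_pos _).le
  rw [design_eq, integral_smul_measure, integral_prod _ hint,
    ENNReal.toReal_ofReal (by positivity), smul_eq_mul]
  have h1 : ∀ t : ℝ, ∫ s in Icc (-1 : ℝ) 1, filterWeight μ x k (t, s) ^ 2 ≤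
      W ^ 2 * ∫ u, k u ^ 2 := by
    intro t
    have hi' : Integrable fun s => k (inner ℝ x (dir t) - s) ^ 2 :=
      hi.comp_sub_left (inner ℝ x (dir t))
    calc _ ≤ ∫ s in Icc (-1 : ℝ) 1, W ^ 2 * k (inner ℝ x (dir t) - s) ^ 2 := by
          refine integral_mono_of_nonneg (Eventually.of_forall fun s => sq_nonneg _)
            (hi'.const_mul _).integrableOn (Eventually.of_forall fun s => ?_)
          simp only [filterWeight, mul_pow]
          gcongr
          exact exp_inner_perp_le μ x _
      _ ≤ ∫ s, W ^ 2 * k (inner ℝ x (dir t) - s) ^ 2 :=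
          setIntegral_le_integral (hi'.const_mul _)
            (Eventually.of_forall fun s => by positivity)
      _ = _ := by
          rw [integral_const_mul, integral_sub_left_eq_self (fun u => k u ^ 2)]
  have h2 : ∫ t in Ico 0 (2 * Real.pi), ∫ s in Icc (-1 : ℝ) 1, filterWeight μ x k (t, s) ^ 2 ≤
      ∫ _ in Ico 0 (2 * Real.pi), W ^ 2 * ∫ u, k u ^ 2 := by
    refine integral_mono_of_nonneg ?_ (integrable_const _) (Eventually.of_forall h1)
    exact Eventually.of_forall fun t => integral_nonneg fun s => sq_nonneg _
  rw [setIntegral_const, Real.volume_real_Ico_of_le (by linarith), smul_eq_mul, sub_zero] at h2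
  have h3 : 0 ≤ W ^ 2 * ∫ u, k u ^ 2 :=
    mul_nonneg (sq_nonneg _) (integral_nonneg fun u => sq_nonneg _)
  calc _ ≤ 1 / (4 * Real.pi) * (2 * Real.pi * (W ^ 2 * ∫ u, k u ^ 2)) := by gcongr
    _ = (W ^ 2 * ∫ u, k u ^ 2) / 2 := by field_simp; norm_num
    _ ≤ _ := by linarith

/-! ### Bernstein bounds for averages of weighted observations -/

lemma exp_le_one_add_add_sq_mul (y : ℝ) : Real.exp y ≤ 1 + y + y ^ 2 * Real.exp |y| := by
  have h1 : Real.exp y - 1 ≤ y * Real.exp y := by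
    have h := Real.add_one_le_exp (-y)
    have h2 := mul_le_mul_of_nonneg_right h (Real.exp_pos y).le
    rw [← Real.exp_add, neg_add_cancel, Real.exp_zero] at h2
    linarith
  rcases le_total 0 y with hy | hy
  · rw [abs_of_nonneg hy]
    nlinarith [mul_le_mul_of_nonneg_left h1 hy]
  · have h3 := Real.add_one_le_exp y
    have h4 : 1 ≤ Real.exp |y| := Real.one_le_exp (abs_nonneg y)
    nlinarith [mul_le_mul_of_nonneg_left h4 (sq_nonneg y),
      mul_nonneg (neg_nonneg.2 hy) (sub_nonneg.2 (by linarith : 1 + y ≤ Real.exp y))]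

lemma sq_mul_exp_abs_le (y : ℝ) : y ^ 2 * Real.exp |y| ≤ 2 * Real.exp (2 * |y|) := by
  have h := Real.pow_div_factorial_le_exp _ (abs_nonneg y) 2
  rw [sq_abs] at h
  norm_num at h
  rw [two_mul |y|, Real.exp_add]
  nlinarith [Real.exp_pos |y|]

lemma fourth_power_le (z : ℝ) : z ^ 4 ≤ 24 * (Real.exp z + Real.exp (-z)) := by
  have h := Real.pow_div_factorial_le_exp _ (abs_nonneg z) 4
  rw [show |z| ^ 4 = z ^ 4 from Even.pow_abs (by decide) z] at h
  have h2 : Real.exp |z| ≤ Real.exp z + Real.exp (-z) := by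
    rcases abs_cases z with ⟨h, -⟩ | ⟨h, -⟩ <;> rw [h] <;>
      linarith [Real.exp_pos z, Real.exp_pos (-z)]
  norm_num [Nat.factorial] at h
  linarith

/-- The exponential moment of the observed values that enters Bernstein's inequality. -/
def noiseConst (σ M : ℝ) : ℝ := ∫ e, 2 * Real.exp (2 * (M + |e|)) ∂(noise σ)

instance (σ : ℝ) : IsProbabilityMeasure (noise σ) := by
  unfold noise; infer_instance

lemma integrable_exp_abs_noise (σ M : ℝ) :
    Integrable (fun e => 2 * Real.exp (2 * (M + |e|))) (noise σ) := by
  have h1 : Integrable (fun e : ℝ => Real.exp (2 * e)) (noise σ) :=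
    integrable_exp_mul_gaussianReal 2
  have h2 : Integrable (fun e : ℝ => Real.exp (-2 * e)) (noise σ) :=
    integrable_exp_mul_gaussianReal (-2)
  refine ((h1.add h2).const_mul (2 * Real.exp (2 * M))).mono'
    (by fun_prop : Continuous fun e : ℝ => 2 * Real.exp (2 * (M + |e|))).aestronglyMeasurable
    (Eventually.of_forall fun e => ?_)
  rw [Real.norm_of_nonneg (by positivity), mul_add, Real.exp_add, ← mul_assoc]
  refine mul_le_mul_of_nonneg_left ?_ (by positivity)
  simp only [Pi.add_apply]
  rcases abs_cases e with ⟨h, -⟩ | ⟨h, -⟩ <;> rw [h]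
  · linarith [Real.exp_pos (-2 * e)]
  · rw [show 2 * -e = -2 * e by ring]
    linarith [Real.exp_pos (2 * e)]

lemma noiseConst_nonneg (σ M : ℝ) : 0 ≤ noiseConst σ M :=
  integral_nonneg fun e => by positivity

lemma integral_noise (σ : ℝ) : ∫ e, e ∂(noise σ) = 0 := by
  unfold noise
  exact integral_id_gaussianReal

lemma integrable_noise (σ : ℝ) : Integrable (fun e : ℝ => e) (noise σ) := by
  refine (integrable_exp_abs_noise σ 0).mono' measurable_id.aestronglyMeasurable
    (Eventually.of_forall fun e => ?_)
  have := Real.add_one_le_exp (2 * (0 + |e|))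
  simp only [Real.norm_eq_abs]
  nlinarith [abs_nonneg e]

section Bernstein

variable {w T : ℝ × ℝ → ℝ} {B M : ℝ}

lemma integrable_weight_sq (hw : Continuous w) (hB : ∀ p, |w p| ≤ B) :
    Integrable (fun p => w p ^ 2) design := by
  refine Integrable.of_bound (C := B ^ 2) (hw.pow 2).aestronglyMeasurable
    (Eventually.of_forall fun p => ?_)
  rw [Real.norm_of_nonneg (sq_nonneg _), ← sq_abs]
  have := hB p
  gcongr

/-- Exponential moment of one summand, from `exp y ≤ 1 + y + y² exp |y|`. Since `|l * w| ≤ 1`, the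
last factor is bounded by an exponential moment of the observed value, which is free of `l` and `w`. -/
lemma mgf_summand_le (σ : ℝ) (hw : Continuous w) (hB : ∀ p, |w p| ≤ B) (hT : Measurable T)
    (hM : ∀ p, |T p| ≤ M) {l : ℝ} (hl : |l| * B ≤ 1) :
    Integrable (fun q : (ℝ × ℝ) × ℝ => Real.exp (l * (w q.1 * (T q.1 + q.2))))
      (design.prod (noise σ)) ∧
    ∫ q, Real.exp (l * (w q.1 * (T q.1 + q.2))) ∂(design.prod (noise σ)) ≤
      Real.exp (l * ∫ p, w p * T p ∂design + l ^ 2 * noiseConst σ M * ∫ p, w p ^ 2 ∂design) := by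
  have hlw : ∀ p, |l * w p| ≤ 1 := fun p => by
    rw [abs_mul]
    exact (mul_le_mul_of_nonneg_left (hB p) (abs_nonneg l)).trans hl
  have hwT : Integrable (fun p => w p * T p) design := by
    refine Integrable.of_bound (C := B * M) (hw.measurable.mul hT).aestronglyMeasurable
      (Eventually.of_forall fun p => ?_)
    rw [norm_mul]
    exact mul_le_mul (hB p) (hM p) (norm_nonneg _) ((abs_nonneg _).trans (hB p))
  have hwi : Integrable w design :=
    Integrable.of_bound (C := B) hw.aestronglyMeasurable (Eventually.of_forall hB)
  have hw2 := integrable_weight_sq hw hB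
  have hN := integrable_exp_abs_noise σ M
  have hi1 : Integrable (fun q : (ℝ × ℝ) × ℝ => w q.1 * T q.1) (design.prod (noise σ)) :=
    hwT.comp_fst _
  have hi2 : Integrable (fun q : (ℝ × ℝ) × ℝ => w q.1 * q.2) (design.prod (noise σ)) :=
    hwi.mul_prod (integrable_noise σ)
  have hi3 : Integrable (fun q : (ℝ × ℝ) × ℝ => w q.1 ^ 2 * (2 * Real.exp (2 * (M + |q.2|))))
      (design.prod (noise σ)) := hw2.mul_prod hN
  have hi12 : Integrable (fun q : (ℝ × ℝ) × ℝ => l * (w q.1 * T q.1 + w q.1 * q.2))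
      (design.prod (noise σ)) := (hi1.add hi2).const_mul l
  have hi123 : Integrable (fun q : (ℝ × ℝ) × ℝ => l * (w q.1 * T q.1 + w q.1 * q.2) +
      l ^ 2 * (w q.1 ^ 2 * (2 * Real.exp (2 * (M + |q.2|))))) (design.prod (noise σ)) :=
    hi12.add (hi3.const_mul _)
  have hdom : Integrable (fun q : (ℝ × ℝ) × ℝ => 1 + (l * (w q.1 * T q.1 + w q.1 * q.2) +
      l ^ 2 * (w q.1 ^ 2 * (2 * Real.exp (2 * (M + |q.2|)))))) (design.prod (noise σ)) :=
    (integrable_const _).add hi123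
  have hpt : ∀ q : (ℝ × ℝ) × ℝ, Real.exp (l * (w q.1 * (T q.1 + q.2))) ≤
      1 + (l * (w q.1 * T q.1 + w q.1 * q.2) +
      l ^ 2 * (w q.1 ^ 2 * (2 * Real.exp (2 * (M + |q.2|))))) := by
    intro q
    set Y := T q.1 + q.2
    have h1 := exp_le_one_add_add_sq_mul (l * (w q.1 * Y))
    have h2 : |l * (w q.1 * Y)| ≤ |Y| := by
      rw [← mul_assoc, abs_mul]
      exact mul_le_of_le_one_left (abs_nonneg _) (hlw _)
    have h3 : |Y| ≤ M + |q.2| := (abs_add_le _ _).trans (by linarith [hM q.1])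
    have h4 : Y ^ 2 * Real.exp |l * (w q.1 * Y)| ≤ 2 * Real.exp (2 * (M + |q.2|)) :=
      calc _ ≤ Y ^ 2 * Real.exp |Y| := by gcongr
        _ ≤ 2 * Real.exp (2 * |Y|) := sq_mul_exp_abs_le Y
        _ ≤ _ := by gcongr
    have h5 := mul_le_mul_of_nonneg_left h4 (mul_nonneg (sq_nonneg l) (sq_nonneg (w q.1)))
    calc _ ≤ _ := h1
      _ = 1 + l * (w q.1 * T q.1 + w q.1 * q.2) +
          l ^ 2 * w q.1 ^ 2 * (Y ^ 2 * Real.exp |l * (w q.1 * Y)|) := by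
        simp only [Y]; ring
      _ ≤ _ := by linarith
  have hint : Integrable (fun q : (ℝ × ℝ) × ℝ => Real.exp (l * (w q.1 * (T q.1 + q.2))))
      (design.prod (noise σ)) := by
    refine hdom.mono' ?_ (Eventually.of_forall fun q => ?_)
    · have : Measurable fun q : (ℝ × ℝ) × ℝ => l * (w q.1 * (T q.1 + q.2)) :=
        measurable_const.mul ((hw.measurable.comp measurable_fst).mul
          ((hT.comp measurable_fst).add measurable_snd))
      exact (Real.measurable_exp.comp this).aestronglyMeasurable
    · rw [Real.norm_of_nonneg (Real.exp_pos _).le]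
      exact hpt q
  refine ⟨hint, (integral_mono hint hdom hpt).trans ?_⟩
  rw [integral_add (integrable_const _) hi123, integral_add hi12 (hi3.const_mul _),
    integral_const_mul,
    integral_const_mul, integral_add hi1 hi2,
    integral_prod_mul w (fun e : ℝ => e), integral_noise,
    integral_prod_mul (fun p => w p ^ 2) (fun e : ℝ => 2 * Real.exp (2 * (M + |e|))),
    integral_fun_fst (fun p => w p * T p)]
  change _ + (_ + l ^ 2 * (_ * noiseConst σ M)) ≤ _
  simp only [integral_const, probReal_univ, one_smul, mul_zero, add_zero]
  refine le_trans (le_of_eq ?_) (Real.add_one_le_exp _)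
  ring

/-- The centered average `n⁻¹ ∑ w(p_i) Y_i - E w T` of weighted observations. -/
def centeredAvg (w T : ℝ × ℝ → ℝ) {n : ℕ} (ω : Fin n → (ℝ × ℝ) × ℝ) : ℝ :=
  1 / (n : ℝ) * ∑ i, w (ω i).1 * (T (ω i).1 + (ω i).2) - ∫ p, w p * T p ∂design

lemma measurable_centeredAvg (hw : Continuous w) (hT : Measurable T) {n : ℕ} :
    Measurable (centeredAvg w T (n := n)) := by
  unfold centeredAvg
  refine (measurable_const.mul (Finset.measurable_sum _ fun i _ => ?_)).sub measurable_const
  exact (hw.measurable.comp (measurable_pi_apply i).fst).mul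
    ((hT.comp (measurable_pi_apply i).fst).add (measurable_pi_apply i).snd)

instance (σ : ℝ) (n : ℕ) : IsProbabilityMeasure (sampleLaw σ n) := by
  unfold sampleLaw; infer_instance

/-- Bernstein's bound for the exponential moments of the centered average. -/
lemma mgf_centeredAvg_le (σ : ℝ) (hw : Continuous w) (hB : ∀ p, |w p| ≤ B) (hT : Measurable T)
    (hM : ∀ p, |T p| ≤ M) {n : ℕ} (hn : 0 < n) {s : ℝ} (hs : |s| * B ≤ n) :
    Integrable (fun ω => Real.exp (s * centeredAvg w T ω)) (sampleLaw σ n) ∧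
    ∫ ω, Real.exp (s * centeredAvg w T ω) ∂(sampleLaw σ n) ≤
      Real.exp (s ^ 2 * (noiseConst σ M * ∫ p, w p ^ 2 ∂design) / n) := by
  have hn' : (0 : ℝ) < n := by exact_mod_cast hn
  set m := ∫ p, w p * T p ∂design with hm
  have hl : |s / n| * B ≤ 1 := by
    rw [abs_div, abs_of_pos hn', div_mul_eq_mul_div]
    exact (div_le_one hn').2 hs
  obtain ⟨hi, hb⟩ := mgf_summand_le σ hw hB hT hM hl
  have e : ∀ ω : Fin n → (ℝ × ℝ) × ℝ, Real.exp (s * centeredAvg w T ω) =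
      Real.exp (-(s * m)) *
        ∏ i, Real.exp (s / n * (w (ω i).1 * (T (ω i).1 + (ω i).2))) := fun ω => by
    rw [← Real.exp_sum, ← Real.exp_add, ← Finset.mul_sum]
    congr 1
    rw [centeredAvg, ← hm]
    ring
  simp only [e]
  constructor
  · exact (Integrable.fintype_prod (f := fun _ : Fin n => fun q : (ℝ × ℝ) × ℝ =>
      Real.exp (s / n * (w q.1 * (T q.1 + q.2)))) fun _ => hi).const_mul _
  · rw [integral_const_mul, sampleLaw, integral_fintype_prod_eq_prod (fun _ : Fin n =>
      fun q : (ℝ × ℝ) × ℝ => Real.exp (s / n * (w q.1 * (T q.1 + q.2)))), Finset.prod_const,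
      Finset.card_univ, Fintype.card_fin]
    have h0 : 0 ≤ ∫ q, Real.exp (s / n * (w q.1 * (T q.1 + q.2))) ∂(design.prod (noise σ)) :=
      integral_nonneg fun q => (Real.exp_pos _).le
    calc _ ≤ Real.exp (-(s * m)) * Real.exp (s / n * m +
          (s / n) ^ 2 * noiseConst σ M * ∫ p, w p ^ 2 ∂design) ^ n := by gcongr
      _ = _ := by
        rw [← Real.exp_nat_mul, ← Real.exp_add]
        congr 1
        field_simp
        ring

/-- Bernstein's inequality for the centered average, before optimization over `s`. -/
lemma measure_centeredAvg_gt_le (σ : ℝ) (hw : Continuous w) (hB : ∀ p, |w p| ≤ B)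
    (hT : Measurable T) (hM : ∀ p, |T p| ≤ M) {n : ℕ} (hn : 0 < n) {s t : ℝ} (hs0 : 0 ≤ s)
    (hs : s * B ≤ n) :
    sampleLaw σ n {ω | t < |centeredAvg w T ω|} ≤ ENNReal.ofReal
      (2 * Real.exp (-(s * t) + s ^ 2 * (noiseConst σ M * ∫ p, w p ^ 2 ∂design) / n)) := by
  set V := s ^ 2 * (noiseConst σ M * ∫ p, w p ^ 2 ∂design) / n with hV
  obtain ⟨i1, b1⟩ := mgf_centeredAvg_le σ hw hB hT hM hn (s := s) (by rwa [abs_of_nonneg hs0])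
  obtain ⟨i2, b2⟩ := mgf_centeredAvg_le σ hw hB hT hM hn (s := -s)
    (by rwa [abs_neg, abs_of_nonneg hs0])
  rw [neg_sq] at b2
  have m1 := measure_ge_le_exp_mul_mgf (X := centeredAvg w T) (μ := sampleLaw σ n) t hs0 i1
  have m2 := measure_ge_le_exp_mul_mgf (X := fun ω => -centeredAvg w T ω) (μ := sampleLaw σ n) t hs0
    (by simpa [neg_mul] using i2)
  have hsub : {ω : Fin n → (ℝ × ℝ) × ℝ | t < |centeredAvg w T ω|} ⊆
      {ω | t ≤ centeredAvg w T ω} ∪ {ω | t ≤ -centeredAvg w T ω} := fun ω hω => by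
    rcases lt_abs.1 (show t < |centeredAvg w T ω| from hω) with h | h
    · exact Or.inl h.le
    · exact Or.inr h.le
  have hfin : (sampleLaw σ n).real {ω | t < |centeredAvg w T ω|} ≤ 2 * Real.exp (-(s * t) + V) := by
    refine (measureReal_mono hsub).trans ((measureReal_union_le _ _).trans ?_)
    rw [Real.exp_add, ← neg_mul, two_mul]
    refine add_le_add (m1.trans ?_) (m2.trans ?_)
    · refine mul_le_mul_of_nonneg_left b1 (Real.exp_pos _).le
    · refine mul_le_mul_of_nonneg_left ?_ (Real.exp_pos _).le
      simpa [mgf, neg_mul] using b2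
  rw [← ofReal_measureReal]
  exact ENNReal.ofReal_le_ofReal hfin

lemma lintegral_centeredAvg_pow_four_le (σ : ℝ) (hw : Continuous w) (hB : ∀ p, |w p| ≤ B)
    (hT : Measurable T) (hM : ∀ p, |T p| ≤ M) {n : ℕ} (hn : 0 < n) {s : ℝ} (hs0 : 0 < s)
    (hs : s * B ≤ n) :
    ∫⁻ ω, ENNReal.ofReal (centeredAvg w T ω ^ 4) ∂(sampleLaw σ n) ≤ ENNReal.ofReal
      (48 * (s ^ 4)⁻¹ * Real.exp (s ^ 2 * (noiseConst σ M * ∫ p, w p ^ 2 ∂design) / n)) := by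
  obtain ⟨i1, b1⟩ := mgf_centeredAvg_le σ hw hB hT hM hn (s := s) (by rwa [abs_of_pos hs0])
  obtain ⟨i2, b2⟩ := mgf_centeredAvg_le σ hw hB hT hM hn (s := -s)
    (by rwa [abs_neg, abs_of_pos hs0])
  rw [neg_sq] at b2
  have hpt : ∀ ω : Fin n → (ℝ × ℝ) × ℝ, centeredAvg w T ω ^ 4 ≤ 24 * (s ^ 4)⁻¹ *
      (Real.exp (s * centeredAvg w T ω) + Real.exp (-s * centeredAvg w T ω)) := fun ω => by
    have h := fourth_power_le (s * centeredAvg w T ω)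
    rw [mul_pow, ← neg_mul] at h
    rw [mul_right_comm, ← div_eq_mul_inv, le_div_iff₀ (by positivity)]
    linarith
  have hi : Integrable (fun ω => 24 * (s ^ 4)⁻¹ * (Real.exp (s * centeredAvg w T ω) +
      Real.exp (-s * centeredAvg w T ω))) (sampleLaw σ n) := (i1.add i2).const_mul _
  calc _ ≤ ∫⁻ ω, ENNReal.ofReal (24 * (s ^ 4)⁻¹ * (Real.exp (s * centeredAvg w T ω) +
        Real.exp (-s * centeredAvg w T ω))) ∂(sampleLaw σ n) :=
        lintegral_mono fun ω => ENNReal.ofReal_le_ofReal (hpt ω)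
    _ = ENNReal.ofReal (∫ ω, 24 * (s ^ 4)⁻¹ * (Real.exp (s * centeredAvg w T ω) +
        Real.exp (-s * centeredAvg w T ω)) ∂(sampleLaw σ n)) := by
        rw [ofReal_integral_eq_lintegral_ofReal hi]
        exact Eventually.of_forall fun ω => by positivity
    _ ≤ _ := by
        refine ENNReal.ofReal_le_ofReal ?_
        rw [integral_const_mul, integral_add i1 i2]
        have := mul_le_mul_of_nonneg_left (add_le_add b1 b2)
          (by positivity : (0 : ℝ) ≤ 24 * (s ^ 4)⁻¹)
        linarith

end Bernstein

/-! ### The stochastic error of the kernel estimators -/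

/-- The bound for the weights `e^{-μ x·θ^⊥}`. -/
def weightBound (μ : ℝ) (x : Plane) : ℝ := Real.exp (|μ| * ‖x‖)

lemma weightBound_pos (μ : ℝ) (x : Plane) : 0 < weightBound μ x := Real.exp_pos _

/-- The bound for the transforms of functions in `classB L`. -/
def transformBound (μ L : ℝ) : ℝ := Real.exp |μ| * L * 2

/-- The stochastic error of the kernel estimator with bandwidth `δ`. -/
def stochErr (μ : ℝ) (x : Plane) (g : Plane → ℝ) (δ : ℝ) {n : ℕ}
    (ω : Fin n → (ℝ × ℝ) × ℝ) : ℝ :=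
  centeredAvg (weight μ x δ) (fun p => transform μ g p.1 p.2) ω

lemma IsDensity.measurable_stochErr (hg : IsDensity L g) (μ : ℝ) (x : Plane) (δ : ℝ) {n : ℕ} :
    Measurable (stochErr μ x g δ (n := n)) :=
  measurable_centeredAvg (continuous_weight μ x) (hg.measurable_transform μ)

lemma IsDensity.integrable_weight_mul (hg : IsDensity L g) (μ : ℝ) (x : Plane) {δ : ℝ}
    (hδ : 0 < δ) :
    Integrable (fun p : ℝ × ℝ => weight μ x δ p * transform μ g p.1 p.2) design := by
  refine Integrable.of_bound (C := Real.exp (|μ| * ‖x‖) * (δ ^ 2)⁻¹ * (Real.exp |μ| * L * 2))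
    ((continuous_weight μ x).measurable.mul
      (hg.measurable_transform μ)).aestronglyMeasurable (Eventually.of_forall fun p => ?_)
  rw [norm_mul]
  exact mul_le_mul (abs_weight_le μ x hδ p) (hg.abs_transform_le μ _ _) (norm_nonneg _)
    (by positivity)

lemma IsDensity.stochErr_sub (hg : IsDensity L g) (μ : ℝ) (x : Plane) {δ η : ℝ} (hδ : 0 < δ)
    (hη : 0 < η) {n : ℕ} (ω : Fin n → (ℝ × ℝ) × ℝ) :
    stochErr μ x g δ ω - stochErr μ x g η ω =
      centeredAvg (filterWeight μ x fun u => filterK μ δ u - filterK μ η u)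
        (fun p => transform μ g p.1 p.2) ω := by
  have h1 := hg.integrable_weight_mul μ x hδ
  have h2 := hg.integrable_weight_mul μ x hη
  simp only [stochErr, centeredAvg, ← weight_sub, sub_mul]
  rw [integral_sub h1 h2, Finset.sum_sub_distrib]
  ring

/-- The fourth moment of the stochastic error, relative to the square of `δ⁻³ / n`. -/
def momentConst (μ σ L : ℝ) (x : Plane) : ℝ :=
  48 * weightBound μ x ^ 4 * Real.exp (noiseConst σ (transformBound μ L) * energyConst μ)

lemma momentConst_pos (μ σ L : ℝ) (x : Plane) : 0 < momentConst μ σ L x := by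
  have := weightBound_pos μ x
  unfold momentConst
  positivity

lemma IsDensity.lintegral_stochErr_pow_four_le (hg : IsDensity L g) (μ σ : ℝ) (x : Plane) {δ : ℝ}
    (hδ : 0 < δ) (hδ1 : δ ≤ 1) {n : ℕ} (hn : 0 < n) (hnδ : 1 ≤ n * δ) :
    ∫⁻ ω, ENNReal.ofReal (stochErr μ x g δ ω ^ 4) ∂(sampleLaw σ n) ≤
      ENNReal.ofReal (momentConst μ σ L x * ((δ ^ 3)⁻¹ / n) ^ 2) := by
  have hn' : (0 : ℝ) < n := by exact_mod_cast hn
  have hW := weightBound_pos μ x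
  set W := weightBound μ x with hWd
  -- `s` is of the order of the inverse standard deviation, and `n * δ ≥ 1` puts it into the range
  -- where the bound for the exponential moments holds
  set s := √(n * δ ^ 3) / W with hs
  have hs0 : 0 < s := by positivity
  have hs2 : s ^ 2 = n * δ ^ 3 / W ^ 2 := by
    rw [hs, div_pow, Real.sq_sqrt (by positivity)]
  obtain ⟨hi, hb⟩ := integrable_filterK_sq μ hδ hδ1
  have hsB : s * (W * (δ ^ 2)⁻¹) ≤ n := by
    have e : s * (W * (δ ^ 2)⁻¹) = √(n * δ ^ 3) / δ ^ 2 := by rw [hs]; field_simp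
    rw [e, div_le_iff₀ (by positivity)]
    refine Real.sqrt_le_iff.2 ⟨by positivity, ?_⟩
    have : (n * δ ^ 2) ^ 2 = n * δ ^ 3 * (n * δ) := by ring
    rw [this]
    exact le_mul_of_one_le_right (by positivity) hnδ
  refine (lintegral_centeredAvg_pow_four_le σ (continuous_weight μ x) (abs_weight_le μ x hδ)
    (hg.measurable_transform μ) (fun p => hg.abs_transform_le μ p.1 p.2) hn hs0 hsB).trans ?_
  refine ENNReal.ofReal_le_ofReal ?_
  have hS : ∫ p, weight μ x δ p ^ 2 ∂design ≤ W ^ 2 * (energyConst μ * (δ ^ 3)⁻¹) := by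
    rw [weight_eq]
    refine (integral_filterWeight_sq_le μ x (continuous_filterK μ) (abs_filterK_le μ hδ)
      hi).trans ?_
    exact mul_le_mul_of_nonneg_left hb (sq_nonneg _)
  have hC := noiseConst_nonneg σ (transformBound μ L)
  have h1 : s ^ 2 * (noiseConst σ (transformBound μ L) * ∫ p, weight μ x δ p ^ 2 ∂design) / n ≤
      noiseConst σ (transformBound μ L) * energyConst μ := by
    calc _ ≤ s ^ 2 * (noiseConst σ (transformBound μ L) *
          (W ^ 2 * (energyConst μ * (δ ^ 3)⁻¹))) / n := by gcongr
      _ = _ := by rw [hs2]; field_simp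
  calc _ ≤ 48 * (s ^ 4)⁻¹ * Real.exp (noiseConst σ (transformBound μ L) * energyConst μ) := by
        gcongr
        exact h1
    _ = _ := by
        rw [show s ^ 4 = (s ^ 2) ^ 2 by ring, hs2, momentConst, ← hWd]
        field_simp

/-- The lower bound for the constant `D`. The two terms beyond `1` serve the Gaussian and the
Poisson range of Bernstein's inequality. -/
def thresholdConst (μ σ L c₂ : ℝ) (x : Plane) : ℝ :=
  1 + 100 * noiseConst σ (transformBound μ L) * weightBound μ x ^ 2 / c₂ +
    80000 * weightBound μ x ^ 2 * freqRatio μ / c₂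

/-- A stochastic error of `f̄_δ - f̄_η` that exceeds the second part of the threshold has a
probability of at most `2 η⁹`. -/
lemma IsDensity.measure_deviation_le (hg : IsDensity L g) (μ σ : ℝ) (x : Plane) {c₂ D : ℝ}
    (hc₂ : 0 < c₂) (hD : thresholdConst μ σ L c₂ x ≤ D) {δ η : ℝ} (hη : 0 < η) (hηδ : 2 * η ≤ δ)
    (hδ1 : δ ≤ 1) {n : ℕ} (hn : 0 < n) (hnη : Real.log (1 / η) ≤ n * η) :
    sampleLaw σ n {ω | vTwo μ c₂ n δ η * lam D η <
      |stochErr μ x g δ ω - stochErr μ x g η ω|} ≤ ENNReal.ofReal (2 * η ^ 9) := by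
  have hn' : (0 : ℝ) < n := by exact_mod_cast hn
  have hW := weightBound_pos μ x
  have hf := one_le_freqRatio μ
  have hf0 : 0 < freqRatio μ := by linarith
  have hδ : 0 < δ := by linarith
  have hCY := noiseConst_nonneg σ (transformBound μ L)
  set W := weightBound μ x with hWd
  set CY := noiseConst σ (transformBound μ L) with hCYd
  set k : ℝ → ℝ := fun u => filterK μ δ u - filterK μ η u with hk
  have hkc : Continuous k := (continuous_filterK μ).sub (continuous_filterK μ)
  set J := ∫ u, k u ^ 2 with hJ
  set l := Real.log (1 / η) with hl
  have hl0 : 0 < l := Real.log_pos (by rw [lt_div_iff₀ hη]; linarith)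
  have hJlow : (200 * freqRatio μ)⁻¹ * (η ^ 3)⁻¹ ≤ J := le_integral_filterK_sub_sq μ hη hηδ hδ1
  have hJ0 : 0 < J := lt_of_lt_of_le (by positivity) hJlow
  have hkB : ∀ u, |k u| ≤ 2 * (η ^ 2)⁻¹ := fun u => by
    have h1 := abs_filterK_le μ hδ u
    have h2 := abs_filterK_le μ hη u
    have h3 : (δ ^ 2)⁻¹ ≤ (η ^ 2)⁻¹ := by gcongr; linarith
    exact (abs_sub _ _).trans (by linarith)
  have hwB : ∀ p, |filterWeight μ x k p| ≤ W * (2 * (η ^ 2)⁻¹) := fun p => by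
    rw [filterWeight, abs_mul, Real.abs_exp]
    exact mul_le_mul (exp_inner_perp_le μ x _) (hkB _) (abs_nonneg _) hW.le
  have hS : ∫ p, filterWeight μ x k p ^ 2 ∂design ≤ W ^ 2 * J :=
    integral_filterWeight_sq_le μ x hkc hkB
      (integrable_filterK_sub_sq μ hη (by linarith) hδ1).1
  -- the two conditions on `D`
  have hA : 0 ≤ 100 * CY * W ^ 2 / c₂ := by positivity
  have hB : 0 ≤ 80000 * W ^ 2 * freqRatio μ / c₂ := by positivity
  have hD' : 1 + 100 * CY * W ^ 2 / c₂ + 80000 * W ^ 2 * freqRatio μ / c₂ ≤ D := hD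
  have hD1 : 100 * CY * W ^ 2 ≤ D * c₂ := by
    rw [← div_le_iff₀ hc₂]; linarith
  have hD2 : 80000 * W ^ 2 * freqRatio μ ≤ D * c₂ := by
    rw [← div_le_iff₀ hc₂]; linarith
  have hD0 : 0 < D := by linarith
  set t := √(c₂ / n * J) * √(D * l) with ht
  have ht0 : 0 < t := by positivity
  have ht2 : t ^ 2 = c₂ / n * J * (D * l) := by
    rw [ht, mul_pow, Real.sq_sqrt (by positivity), Real.sq_sqrt (by positivity)]
  have htle : t ≤ vTwo μ c₂ n δ η * lam D η :=
    mul_le_mul_of_nonneg_left (le_max_right _ _) (Real.sqrt_nonneg _)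
  -- with this `s` the exponent in Bernstein's inequality is `-10 * l` plus a variance term of at
  -- most `l`
  set s := 10 * l / t with hs
  have hs0 : 0 ≤ s := by positivity
  have hst : s * t = 10 * l := by rw [hs]; field_simp
  have hsB : s * (W * (2 * (η ^ 2)⁻¹)) ≤ n := by
    rw [hs, div_mul_eq_mul_div, div_le_iff₀ ht0]
    refine le_of_sq_le_sq ?_ (by positivity)
    calc (10 * l * (W * (2 * (η ^ 2)⁻¹))) ^ 2 = l * (400 * W ^ 2) * (η ^ 4)⁻¹ * l := by
          field_simp
          ring
      _ ≤ l * (400 * W ^ 2) * (η ^ 4)⁻¹ * (n * η) := by gcongr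
      _ = n * l * (80000 * W ^ 2 * freqRatio μ) * ((200 * freqRatio μ)⁻¹ * (η ^ 3)⁻¹) := by
          field_simp
          ring
      _ ≤ n * l * (D * c₂) * J := by gcongr
      _ = (n * t) ^ 2 := by
          rw [mul_pow, ht2]
          field_simp
  have hcov : {ω : Fin n → (ℝ × ℝ) × ℝ | vTwo μ c₂ n δ η * lam D η <
      |stochErr μ x g δ ω - stochErr μ x g η ω|} ⊆
      {ω | t < |centeredAvg (filterWeight μ x k) (fun p => transform μ g p.1 p.2) ω|} := by
    intro ω hω
    have hω' : vTwo μ c₂ n δ η * lam D η < |stochErr μ x g δ ω - stochErr μ x g η ω| := hω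
    rw [hg.stochErr_sub μ x hδ hη] at hω'
    exact htle.trans_lt hω'
  refine (measure_mono hcov).trans ((measure_centeredAvg_gt_le σ (continuous_filterWeight μ x hkc)
    hwB (hg.measurable_transform μ) (fun p => hg.abs_transform_le μ p.1 p.2) hn hs0 hsB).trans ?_)
  refine ENNReal.ofReal_le_ofReal (mul_le_mul_of_nonneg_left ?_ zero_le_two)
  have hV : s ^ 2 * (CY * ∫ p, filterWeight μ x k p ^ 2 ∂design) / n ≤ l := by
    calc _ ≤ s ^ 2 * (CY * (W ^ 2 * J)) / n := by gcongr
      _ = (100 * CY * W ^ 2) / (D * c₂) * l := by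
        rw [hs, div_pow, ht2]
        field_simp
        ring
      _ ≤ 1 * l := by
        gcongr
        exact (div_le_one (by positivity)).2 hD1
      _ = l := one_mul l
  have hη9 : η ^ 9 = Real.exp (-(9 * l)) := by
    rw [hl, one_div, Real.log_inv, mul_neg, neg_neg]
    rw [← Real.exp_log (pow_pos hη 9), Real.log_pow]
    norm_num
  rw [hη9, hst]
  refine Real.exp_le_exp.2 ?_
  change -(10 * l) + s ^ 2 * (CY * ∫ p, filterWeight μ x k p ^ 2 ∂design) / n ≤ _
  linarith

/-! ### The selected bandwidth and the oracle bandwidth -/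

/-- The mean of the kernel estimator with bandwidth `δ`. -/
def meanEst (μ : ℝ) (x : Plane) (g : Plane → ℝ) (δ : ℝ) : ℝ :=
  ∫ p, weight μ x δ p * transform μ g p.1 p.2 ∂design

lemma kernelEst_observe (μ : ℝ) (x : Plane) (g : Plane → ℝ) (δ : ℝ) {n : ℕ}
    (ω : Fin n → (ℝ × ℝ) × ℝ) :
    kernelEst μ x δ (observe μ g ω) = stochErr μ x g δ ω + meanEst μ x g δ := by
  simp only [kernelEst, stochErr, centeredAvg, meanEst, observe, weight]
  ring

lemma tsum_ofReal_geometric_le {c r : ℝ} (hc : 0 ≤ c) (hr0 : 0 ≤ r) (hr : r ≤ 1 / 2) :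
    ∑' k : ℕ, ENNReal.ofReal (c * r ^ k) ≤ ENNReal.ofReal (2 * c) := by
  have hs : Summable fun k : ℕ => c * r ^ k :=
    (summable_geometric_of_lt_one hr0 (by linarith)).mul_left c
  rw [← ENNReal.ofReal_tsum_of_nonneg (fun k => by positivity) hs, tsum_mul_left,
    tsum_geometric_of_lt_one hr0 (by linarith), mul_comm 2 c]
  refine ENNReal.ofReal_le_ofReal (mul_le_mul_of_nonneg_left ?_ hc)
  rw [inv_le_comm₀ (by linarith) two_pos]
  linarith

section Grid

variable {a : ℝ} {n : ℕ}

lemma inv_pow_pos (ha : 2 ≤ a) (j : ℕ) : 0 < a⁻¹ ^ j := by positivity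

lemma inv_le_half (ha : 2 ≤ a) : a⁻¹ ≤ 1 / 2 := by
  rw [one_div]
  gcongr

lemma inv_pow_le_one (ha : 2 ≤ a) (j : ℕ) : a⁻¹ ^ j ≤ 1 :=
  pow_le_one₀ (by positivity) (by linarith [inv_le_half ha])

lemma inv_pow_lt_inv_pow (ha : 2 ≤ a) {j k : ℕ} : a⁻¹ ^ k < a⁻¹ ^ j ↔ j < k :=
  pow_lt_pow_iff_right_of_lt_one₀ (by positivity) (by linarith [inv_le_half ha])

lemma two_mul_inv_pow_le (ha : 2 ≤ a) {j k : ℕ} (h : j < k) : 2 * a⁻¹ ^ k ≤ a⁻¹ ^ j := by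
  have h1 : a⁻¹ ^ k ≤ a⁻¹ ^ (j + 1) :=
    pow_le_pow_of_le_one (by positivity) (by linarith [inv_le_half ha]) h
  rw [pow_succ] at h1
  nlinarith [inv_le_half ha, inv_pow_pos ha j]

lemma one_le_log (hn : 3 ≤ n) : 1 ≤ Real.log n := by
  rw [Real.le_log_iff_exp_le (by positivity)]
  have : (3 : ℝ) ≤ n := by exact_mod_cast hn
  linarith [Real.exp_one_lt_d9]

lemma grid_pos (hn : 3 ≤ n) {δ : ℝ} (hδ : δ ∈ grid a n) : 0 < δ := by
  have h : 0 < Real.log n / n := by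
    have := one_le_log hn
    positivity
  exact h.trans_le hδ.1.1

lemma log_le_mul_of_mem_grid (hn : 3 ≤ n) {δ : ℝ} (hδ : δ ∈ grid a n) :
    Real.log n ≤ n * δ := by
  have := hδ.1.1
  rw [div_le_iff₀ (by positivity)] at this
  linarith

lemma one_le_mul_of_mem_grid (hn : 3 ≤ n) {δ : ℝ} (hδ : δ ∈ grid a n) : 1 ≤ n * δ :=
  (one_le_log hn).trans (log_le_mul_of_mem_grid hn hδ)

lemma log_inv_le_log (hn : 3 ≤ n) {δ : ℝ} (hδ : δ ∈ grid a n) :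
    Real.log (1 / δ) ≤ Real.log n := by
  have h0 := grid_pos hn hδ
  refine Real.log_le_log (by positivity) ?_
  rw [div_le_iff₀ h0]
  exact one_le_mul_of_mem_grid hn hδ

lemma grid_finite (ha : 2 ≤ a) (hn : 3 ≤ n) : (grid a n).Finite := by
  have h : 0 < Real.log n / n := by
    have := one_le_log hn
    positivity
  have ht := tendsto_pow_atTop_nhds_zero_of_lt_one (by positivity : 0 ≤ a⁻¹)
    (by linarith [inv_le_half ha])
  obtain ⟨N, hN⟩ := eventually_atTop.1 (ht.eventually_lt_const h)
  refine ((finite_Iio N).image fun j : ℕ => a⁻¹ ^ j).subset ?_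
  rintro δ ⟨hδ, j, rfl⟩
  refine ⟨j, ?_, rfl⟩
  by_contra hc
  exact absurd hδ.1 (not_le.2 (hN j (not_lt.1 hc)))

lemma inv_pow_mem_grid (ha : 2 ≤ a) {j k : ℕ} (hjk : j ≤ k) (hk : a⁻¹ ^ k ∈ grid a n) :
    a⁻¹ ^ j ∈ grid a n :=
  ⟨⟨hk.1.1.trans (pow_le_pow_of_le_one (by positivity) (by linarith [inv_le_half ha]) hjk),
    inv_pow_le_one ha j⟩, j, rfl⟩

end Grid

lemma lam_nonneg (D δ : ℝ) : 0 ≤ lam D δ := zero_le_one.trans (le_max_left _ _)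

lemma threshold_nonneg (μ c₁ c₂ D : ℝ) (n : ℕ) (δ η : ℝ) : 0 ≤ threshold μ c₁ c₂ D n δ η :=
  add_nonneg (mul_nonneg (Real.sqrt_nonneg _) (lam_nonneg D δ))
    (mul_nonneg (Real.sqrt_nonneg _) (lam_nonneg D η))

/-- The bandwidths `δ` that pass the comparison with all smaller bandwidths of the grid. -/
def admissible (μ c₁ c₂ D a : ℝ) (x : Plane) {n : ℕ} (d : Fin n → Obs) : Set ℝ :=
  {δ | δ ∈ grid a n ∧ ∀ η ∈ grid a n, η ≤ δ →
    |kernelEst μ x δ d - kernelEst μ x η d| ≤ threshold μ c₁ c₂ D n δ η}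

/-- The supremum in the definition of the data-driven bandwidth is attained. -/
lemma adaptiveBandwidth_mem (μ c₁ c₂ D : ℝ) {a : ℝ} (ha : 2 ≤ a) (x : Plane) {n : ℕ} (hn : 3 ≤ n)
    (hne : (grid a n).Nonempty) (d : Fin n → Obs) :
    adaptiveBandwidth μ c₁ c₂ D a x d ∈ admissible μ c₁ c₂ D a x d := by
  have hfin := grid_finite ha hn
  have hfin' : (admissible μ c₁ c₂ D a x d).Finite := hfin.subset fun δ h => h.1
  refine Set.Nonempty.csSup_mem ?_ hfin'
  obtain ⟨δ, hδ, hmin⟩ := Set.exists_min_image _ id hfin hne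
  refine ⟨δ, hδ, fun η hη hle => ?_⟩
  rw [le_antisymm hle (hmin η hη), sub_self, abs_zero]
  exact threshold_nonneg _ _ _ _ _ _ _

lemma le_adaptiveBandwidth (μ c₁ c₂ D : ℝ) {a : ℝ} (ha : 2 ≤ a) (x : Plane) {n : ℕ} (hn : 3 ≤ n)
    (d : Fin n → Obs) {δ : ℝ} (hδ : δ ∈ admissible μ c₁ c₂ D a x d) :
    δ ≤ adaptiveBandwidth μ c₁ c₂ D a x d :=
  le_csSup (((grid_finite ha hn).subset fun _ h => h.1 :
    (admissible μ c₁ c₂ D a x d).Finite).bddAbove) hδ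

/-- The event that the stochastic errors at `a⁻ʲ` and `a⁻ᵏ` differ by more than the second part of
the threshold. -/
def deviation (μ c₂ D a : ℝ) (x : Plane) (g : Plane → ℝ) (n j k : ℕ) :
    Set (Fin n → (ℝ × ℝ) × ℝ) :=
  {ω | vTwo μ c₂ n (a⁻¹ ^ j) (a⁻¹ ^ k) * lam D (a⁻¹ ^ k) <
    |stochErr μ x g (a⁻¹ ^ j) ω - stochErr μ x g (a⁻¹ ^ k) ω|}

/-- The event on which the selection procedure may reject `a⁻ʲ` although its bias is dominated by
the threshold. -/
def rejection (μ c₂ D a : ℝ) (x : Plane) (g : Plane → ℝ) (n j : ℕ) :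
    Set (Fin n → (ℝ × ℝ) × ℝ) :=
  ⋃ k, ⋃ (_ : j < k ∧ a⁻¹ ^ k ∈ grid a n), deviation μ c₂ D a x g n j k

lemma IsDensity.measurableSet_rejection (hg : IsDensity L g) (μ c₂ D a : ℝ) (x : Plane) (n j : ℕ) :
    MeasurableSet (rejection μ c₂ D a x g n j) := by
  refine MeasurableSet.iUnion fun k => MeasurableSet.iUnion fun _ => ?_
  exact measurableSet_lt measurable_const (measurable_abs.comp
    ((hg.measurable_stochErr μ x _).sub (hg.measurable_stochErr μ x _)))

lemma IsDensity.measure_rejection_le (hg : IsDensity L g) (μ σ : ℝ) (x : Plane) {c₂ D a : ℝ}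
    (hc₂ : 0 < c₂) (hD : thresholdConst μ σ L c₂ x ≤ D) (ha : 2 ≤ a) {n : ℕ} (hn : 3 ≤ n)
    (j : ℕ) :
    sampleLaw σ n (rejection μ c₂ D a x g n j) ≤ ENNReal.ofReal (4 * (a⁻¹ ^ (j + 1)) ^ 8) := by
  refine (measure_iUnion_le _).trans ?_
  have h : ∀ k, sampleLaw σ n (⋃ (_ : j < k ∧ a⁻¹ ^ k ∈ grid a n), deviation μ c₂ D a x g n j k) ≤
      ENNReal.ofReal (2 * (a⁻¹ ^ (j + 1)) ^ 8 * a⁻¹ ^ k) := by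
    intro k
    by_cases hk : j < k ∧ a⁻¹ ^ k ∈ grid a n
    · simp only [hk, and_self, iUnion_true]
      refine (hg.measure_deviation_le μ σ x hc₂ hD (inv_pow_pos ha k) (two_mul_inv_pow_le ha hk.1)
        (inv_pow_le_one ha j) (by omega) ((log_inv_le_log hn hk.2).trans
          (log_le_mul_of_mem_grid hn hk.2))).trans (ENNReal.ofReal_le_ofReal ?_)
      have h1 : a⁻¹ ^ k ≤ a⁻¹ ^ (j + 1) :=
        pow_le_pow_of_le_one (by positivity) (by linarith [inv_le_half ha]) hk.1
      have h0 := inv_pow_pos ha k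
      calc 2 * (a⁻¹ ^ k) ^ 9 = 2 * (a⁻¹ ^ k) ^ 8 * a⁻¹ ^ k := by ring
        _ ≤ _ := by gcongr
    · rw [iUnion_eq_empty.2 fun h => absurd h hk, measure_empty]
      exact zero_le
  refine (ENNReal.tsum_le_tsum h).trans ((tsum_ofReal_geometric_le (by positivity) (by positivity)
    (inv_le_half ha)).trans_eq ?_)
  congr 1
  ring

/-- On the event of a wrong rejection the squared stochastic error is small on average, since the
event has a probability of at most a high power of the bandwidth. -/
lemma IsDensity.lintegral_indicator_rejection_le (hg : IsDensity L g) (μ σ : ℝ) (x : Plane)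
    {c₂ D a : ℝ} (hc₂ : 0 < c₂) (hD : thresholdConst μ σ L c₂ x ≤ D) (ha : 2 ≤ a) {n : ℕ}
    (hn : 3 ≤ n) (j : ℕ) (hj : a⁻¹ ^ (j + 1) ∈ grid a n) :
    ∫⁻ ω, (rejection μ c₂ D a x g n j).indicator
        (fun ω => ENNReal.ofReal (stochErr μ x g (a⁻¹ ^ (j + 1)) ω ^ 2)) ω ∂(sampleLaw σ n) ≤
      ENNReal.ofReal ((momentConst μ σ L x + 4) / n * a⁻¹ ^ j) := by
  set δ := a⁻¹ ^ (j + 1) with hδ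
  have hδ0 : 0 < δ := inv_pow_pos ha _
  have hδ1 : δ ≤ 1 := inv_pow_le_one ha _
  have hn' : (0 : ℝ) < n := by positivity
  set V := (δ ^ 3)⁻¹ / n with hV
  have hV0 : 0 < V := by positivity
  have hMC := momentConst_pos μ σ L x
  have hpt : ∀ ω, (rejection μ c₂ D a x g n j).indicator
      (fun ω => ENNReal.ofReal (stochErr μ x g δ ω ^ 2)) ω ≤
      ENNReal.ofReal (V⁻¹ * δ ^ 4) * ENNReal.ofReal (stochErr μ x g δ ω ^ 4) +
        (rejection μ c₂ D a x g n j).indicator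
          (fun _ => ENNReal.ofReal (V * (δ ^ 4)⁻¹)) ω := by
    intro ω
    by_cases h : ω ∈ rejection μ c₂ D a x g n j
    · rw [indicator_of_mem h, indicator_of_mem h, ← ENNReal.ofReal_mul (by positivity),
        ← ENNReal.ofReal_add (by positivity) (by positivity)]
      refine ENNReal.ofReal_le_ofReal ?_
      have := norm_le_weighted (w := V⁻¹ * δ ^ 4) (F := stochErr μ x g δ ω ^ 2) (τ := 1)
        (by positivity) one_pos
      rw [mul_inv, inv_inv] at this
      linarith
    · rw [indicator_of_notMem h]
      exact zero_le
  refine (lintegral_mono hpt).trans ?_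
  rw [lintegral_add_left (by
    exact ((hg.measurable_stochErr μ x δ).pow_const 4).ennreal_ofReal.const_mul _),
    lintegral_const_mul _ ((hg.measurable_stochErr μ x δ).pow_const 4).ennreal_ofReal]
  have h1 := hg.lintegral_stochErr_pow_four_le μ σ x hδ0 hδ1 (by omega : 0 < n)
    (one_le_mul_of_mem_grid hn hj)
  have h2 := hg.measure_rejection_le μ σ x hc₂ hD ha hn j
  calc _ ≤ ENNReal.ofReal (V⁻¹ * δ ^ 4) * ENNReal.ofReal (momentConst μ σ L x * V ^ 2) +
        ENNReal.ofReal (V * (δ ^ 4)⁻¹) * ENNReal.ofReal (4 * δ ^ 8) := by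
        refine add_le_add (mul_le_mul_right h1 _) ((lintegral_indicator_const_le _ _).trans ?_)
        exact mul_le_mul_right h2 _
    _ = ENNReal.ofReal ((momentConst μ σ L x + 4) / n * δ) := by
        rw [← ENNReal.ofReal_mul (by positivity), ← ENNReal.ofReal_mul (by positivity),
          ← ENNReal.ofReal_add (by positivity) (by positivity)]
        congr 1
        rw [hV]
        field_simp
    _ ≤ _ := by
        refine ENNReal.ofReal_le_ofReal (mul_le_mul_of_nonneg_left ?_ (by positivity))
        rw [hδ]
        exact pow_le_pow_of_le_one (by positivity) (by linarith [inv_le_half ha]) (Nat.le_succ j)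

/-- The squared error of the adaptive estimator is compared with the one at the oracle bandwidth
`a⁻ᴶ`: a larger selected bandwidth passed the comparison with `a⁻ᴶ`, while a smaller selected
bandwidth `a⁻⁽ʲ⁺¹⁾` means that `a⁻ʲ` was rejected. -/
lemma sq_error_le (μ c₁ c₂ D : ℝ) {a : ℝ} (ha : 2 ≤ a) (x : Plane) (g : Plane → ℝ)
    {n : ℕ} (hn : 3 ≤ n) (y : ℝ) (b : ℝ → ℝ) (hb : ∀ δ, 0 < δ → |meanEst μ x g δ - y| ≤ b δ)
    (hmono : ∀ δ δ', 0 < δ → δ ≤ δ' → b δ ≤ b δ') {J : ℕ} (hJ : a⁻¹ ^ J ∈ grid a n)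
    (hbal : ∀ δ ∈ grid a n, δ ≤ a⁻¹ ^ J → 2 * b δ ≤ vOne c₁ n δ * lam D δ) {Ψ : ℝ}
    (hΨ : ∀ δ ∈ grid a n, a⁻¹ ^ J ≤ δ → threshold μ c₁ c₂ D n δ (a⁻¹ ^ J) ≤ Ψ)
    (ω : Fin n → (ℝ × ℝ) × ℝ) :
    ENNReal.ofReal ((adaptiveEst μ c₁ c₂ D a x (observe μ g ω) - y) ^ 2) ≤
      ENNReal.ofReal (3 * Ψ ^ 2 + 3 * b (a⁻¹ ^ J) ^ 2) +
      ENNReal.ofReal 3 * ENNReal.ofReal (stochErr μ x g (a⁻¹ ^ J) ω ^ 2) +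
      ∑' j, {j | a⁻¹ ^ (j + 1) ∈ grid a n}.indicator (fun j => ENNReal.ofReal 2 *
        (rejection μ c₂ D a x g n j).indicator
          (fun ω => ENNReal.ofReal (stochErr μ x g (a⁻¹ ^ (j + 1)) ω ^ 2)) ω) j := by
  set d := observe μ g ω with hd
  set δs := a⁻¹ ^ J with hδs
  have hδs0 : 0 < δs := inv_pow_pos ha J
  have hmem := adaptiveBandwidth_mem μ c₁ c₂ D ha x hn ⟨δs, hJ⟩ d
  have hsup := fun δ hδ => le_adaptiveBandwidth μ c₁ c₂ D ha x hn d (δ := δ) hδ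
  rw [adaptiveEst]
  set δb := adaptiveBandwidth μ c₁ c₂ D a x d
  have hbs : 0 ≤ b δs := (abs_nonneg _).trans (hb _ hδs0)
  rcases le_or_gt δs δb with hcase | hcase
  · refine le_trans ?_ le_self_add
    rw [← ENNReal.ofReal_mul (by norm_num), ← ENNReal.ofReal_add (by positivity) (by positivity)]
    refine ENNReal.ofReal_le_ofReal ?_
    have h1 := (hmem.2 δs hJ hcase).trans (hΨ δb hmem.1 hcase)
    have h2 := hb δs hδs0
    have e : kernelEst μ x δb d - y = (kernelEst μ x δb d - kernelEst μ x δs d) +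
        stochErr μ x g δs ω + (meanEst μ x g δs - y) := by
      rw [hd, kernelEst_observe μ x g δs ω]
      ring
    rw [e]
    set A := kernelEst μ x δb d - kernelEst μ x δs d
    set Z := stochErr μ x g δs ω
    set E := meanEst μ x g δs - y
    have hA := pow_le_pow_left₀ (abs_nonneg _) h1 2
    have hE := pow_le_pow_left₀ (abs_nonneg _) h2 2
    rw [sq_abs] at hA hE
    nlinarith [sq_nonneg (A - Z), sq_nonneg (A - E), sq_nonneg (Z - E)]
  · obtain ⟨hgb, hadm⟩ := hmem
    obtain ⟨i, hi⟩ := hgb.2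
    have hJi : J < i := by
      rw [← inv_pow_lt_inv_pow ha, ← hi]
      exact hcase
    obtain ⟨j, rfl⟩ : ∃ j, i = j + 1 := ⟨i - 1, by omega⟩
    have hgj : a⁻¹ ^ (j + 1) ∈ grid a n := hi ▸ hgb
    have hgj' : a⁻¹ ^ j ∈ grid a n := inv_pow_mem_grid ha (Nat.le_succ j) hgj
    have hjJ : a⁻¹ ^ j ≤ δs :=
      pow_le_pow_of_le_one (by positivity) (by linarith [inv_le_half ha]) (by omega)
    have hj0 : 0 < a⁻¹ ^ j := inv_pow_pos ha j
    have hnot : ¬ a⁻¹ ^ j ∈ admissible μ c₁ c₂ D a x d := fun hc => by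
      have h1 := hsup _ hc
      rw [hi] at h1
      exact absurd h1 (not_le.2 ((inv_pow_lt_inv_pow ha).2 (Nat.lt_succ_self j)))
    have hrej : ω ∈ rejection μ c₂ D a x g n j := by
      have h1 : ∃ η ∈ grid a n, η ≤ a⁻¹ ^ j ∧ threshold μ c₁ c₂ D n (a⁻¹ ^ j) η <
          |kernelEst μ x (a⁻¹ ^ j) d - kernelEst μ x η d| := by
        by_contra hc
        push Not at hc
        exact hnot ⟨hgj', hc⟩
      obtain ⟨η, hη, hle, hlt⟩ := h1
      obtain ⟨k, hk⟩ := hη.2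
      have hη0 := grid_pos hn hη
      have hne : η ≠ a⁻¹ ^ j := fun hc => by
        rw [hc, sub_self, abs_zero] at hlt
        exact absurd hlt (not_lt.2 (threshold_nonneg _ _ _ _ _ _ _))
      have hjk : j < k := by
        rw [← inv_pow_lt_inv_pow ha, ← hk]
        exact lt_of_le_of_ne hle hne
      refine mem_iUnion.2 ⟨k, mem_iUnion.2 ⟨⟨hjk, hk ▸ hη⟩, ?_⟩⟩
      change vTwo μ c₂ n (a⁻¹ ^ j) (a⁻¹ ^ k) * lam D (a⁻¹ ^ k) <
        |stochErr μ x g (a⁻¹ ^ j) ω - stochErr μ x g (a⁻¹ ^ k) ω|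
      rw [← hk]
      rw [hd, kernelEst_observe, kernelEst_observe] at hlt
      have h2 := hb _ hj0
      have h3 := (hb _ hη0).trans (hmono _ _ hη0 hle)
      have h4 := hbal _ hgj' hjJ
      have h5 : |stochErr μ x g (a⁻¹ ^ j) ω + meanEst μ x g (a⁻¹ ^ j) -
          (stochErr μ x g η ω + meanEst μ x g η)| ≤
          |stochErr μ x g (a⁻¹ ^ j) ω - stochErr μ x g η ω| +
          |(meanEst μ x g (a⁻¹ ^ j) - y) - (meanEst μ x g η - y)| := by
        refine le_trans (le_of_eq ?_) (abs_add_le _ _)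
        congr 1
        ring
      have h6 := abs_sub (meanEst μ x g (a⁻¹ ^ j) - y) (meanEst μ x g η - y)
      rw [threshold] at hlt
      linarith
    have hterm : ENNReal.ofReal ((kernelEst μ x δb d - y) ^ 2) ≤
        ENNReal.ofReal (3 * Ψ ^ 2 + 3 * b δs ^ 2) +
        ENNReal.ofReal 2 * ENNReal.ofReal (stochErr μ x g (a⁻¹ ^ (j + 1)) ω ^ 2) := by
      rw [← ENNReal.ofReal_mul (by norm_num), ← ENNReal.ofReal_add (by positivity) (by positivity)]
      refine ENNReal.ofReal_le_ofReal ?_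
      have hb0 : 0 < δb := grid_pos hn hgb
      have h2 := (hb δb hb0).trans (hmono _ _ hb0 hcase.le)
      rw [hd, kernelEst_observe, ← hi, add_sub_assoc]
      have hE := pow_le_pow_left₀ (abs_nonneg _) h2 2
      rw [sq_abs] at hE
      nlinarith [sq_nonneg (stochErr μ x g δb ω - (meanEst μ x g δb - y)), sq_nonneg Ψ,
        sq_nonneg (b δs)]
    refine hterm.trans (add_le_add le_self_add ?_)
    refine le_trans (le_of_eq ?_) (ENNReal.le_tsum j)
    rw [indicator_of_mem (show j ∈ {j | a⁻¹ ^ (j + 1) ∈ grid a n} from hgj),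
      indicator_of_mem hrej]

/-! ### The oracle bound and its rate -/

/-- The risk only depends on the almost everywhere class of `f`, apart from the value `f x` that is
estimated. -/
lemma risk_eq_of_ae_eq (h : f =ᵐ[volume] g) (μ σ : ℝ) {n : ℕ} (est : (Fin n → Obs) → ℝ)
    (x : Plane) :
    risk μ σ est f x =
      ∫⁻ ω, ENNReal.ofReal ((est (observe μ g ω) - f x) ^ 2) ∂(sampleLaw σ n) := by
  refine lintegral_congr_ae ?_
  have h1 : ∀ i : Fin n, ∀ᵐ ω ∂(sampleLaw σ n),
      transform μ f (ω i).1.1 (ω i).1.2 = transform μ g (ω i).1.1 (ω i).1.2 := fun i => by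
    have h2 : ∀ᵐ q ∂(design.prod (noise σ)),
        transform μ f q.1.1 q.1.2 = transform μ g q.1.1 q.1.2 :=
      Measure.quasiMeasurePreserving_fst.ae (transform_ae_eq h μ)
    exact (measurePreserving_eval (fun _ : Fin n => design.prod (noise σ))
      i).quasiMeasurePreserving.ae h2
  filter_upwards [ae_all_iff.2 h1] with ω hω
  have : observe μ f ω = observe μ g ω := by
    funext i
    simp only [observe, hω i]
  rw [this]

lemma IsDensity.lintegral_stochErr_sq_le (hg : IsDensity L g) (μ σ : ℝ) (x : Plane) {δ : ℝ}
    (hδ : 0 < δ) (hδ1 : δ ≤ 1) {n : ℕ} (hn : 0 < n) (hnδ : 1 ≤ n * δ) :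
    ∫⁻ ω, ENNReal.ofReal (stochErr μ x g δ ω ^ 2) ∂(sampleLaw σ n) ≤
      ENNReal.ofReal ((1 + momentConst μ σ L x) * ((δ ^ 3)⁻¹ / n)) := by
  have hn' : (0 : ℝ) < n := by exact_mod_cast hn
  have hMC := momentConst_pos μ σ L x
  set V := (δ ^ 3)⁻¹ / n with hV
  have hV0 : 0 < V := by positivity
  have hpt : ∀ ω : Fin n → (ℝ × ℝ) × ℝ, ENNReal.ofReal (stochErr μ x g δ ω ^ 2) ≤
      ENNReal.ofReal V + ENNReal.ofReal V⁻¹ * ENNReal.ofReal (stochErr μ x g δ ω ^ 4) := by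
    intro ω
    rw [← ENNReal.ofReal_mul (by positivity), ← ENNReal.ofReal_add (by positivity) (by positivity)]
    refine ENNReal.ofReal_le_ofReal ?_
    have := norm_le_weighted (w := V⁻¹) (F := stochErr μ x g δ ω ^ 2) (τ := 1)
      (by positivity) one_pos
    rw [inv_inv] at this
    linarith
  refine (lintegral_mono hpt).trans ?_
  rw [lintegral_add_left measurable_const, lintegral_const, measure_univ, mul_one,
    lintegral_const_mul _ ((hg.measurable_stochErr μ x δ).pow_const 4).ennreal_ofReal]
  refine (add_le_add_right (mul_le_mul_right
    (hg.lintegral_stochErr_pow_four_le μ σ x hδ hδ1 hn hnδ) _) _).trans_eq ?_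
  rw [← ENNReal.ofReal_mul (by positivity), ← ENNReal.ofReal_add (by positivity) (by positivity)]
  congr 1
  rw [← hV]
  field_simp

lemma IsDensity.risk_le (hg : IsDensity L g) (hfg : f =ᵐ[volume] g) (μ σ : ℝ) (x : Plane)
    {c₁ c₂ D : ℝ} (hc₂ : 0 < c₂) (hD : thresholdConst μ σ L c₂ x ≤ D) {a : ℝ} (ha : 2 ≤ a)
    {n : ℕ} (hn : 3 ≤ n) (b : ℝ → ℝ) (hb : ∀ δ, 0 < δ → |meanEst μ x g δ - f x| ≤ b δ)
    (hmono : ∀ δ δ', 0 < δ → δ ≤ δ' → b δ ≤ b δ') {J : ℕ} (hJ : a⁻¹ ^ J ∈ grid a n)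
    (hbal : ∀ δ ∈ grid a n, δ ≤ a⁻¹ ^ J → 2 * b δ ≤ vOne c₁ n δ * lam D δ) {Ψ : ℝ}
    (hΨ : ∀ δ ∈ grid a n, a⁻¹ ^ J ≤ δ → threshold μ c₁ c₂ D n δ (a⁻¹ ^ J) ≤ Ψ) :
    risk μ σ (n := n) (adaptiveEst μ c₁ c₂ D a x) f x ≤
      ENNReal.ofReal (3 * Ψ ^ 2 + 3 * b (a⁻¹ ^ J) ^ 2 +
        3 * ((1 + momentConst μ σ L x) * (((a⁻¹ ^ J) ^ 3)⁻¹ / n)) +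
        4 * ((momentConst μ σ L x + 4) / n)) := by
  have hn' : (0 : ℝ) < n := by positivity
  have hMC := momentConst_pos μ σ L x
  have hJ0 := inv_pow_pos ha J
  rw [risk_eq_of_ae_eq hfg]
  refine (lintegral_mono fun ω => sq_error_le μ c₁ c₂ D ha x g hn (f x) b hb hmono hJ hbal hΨ
    ω).trans ?_
  have hZm : ∀ δ, Measurable fun ω : Fin n → (ℝ × ℝ) × ℝ =>
      ENNReal.ofReal (stochErr μ x g δ ω ^ 2) := fun δ =>
    ((hg.measurable_stochErr μ x δ).pow_const 2).ennreal_ofReal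
  have hterm : ∀ j : ℕ, Measurable fun ω : Fin n → (ℝ × ℝ) × ℝ =>
      {j | a⁻¹ ^ (j + 1) ∈ grid a n}.indicator (fun j => ENNReal.ofReal 2 *
        (rejection μ c₂ D a x g n j).indicator
          (fun ω => ENNReal.ofReal (stochErr μ x g (a⁻¹ ^ (j + 1)) ω ^ 2)) ω) j := fun j => by
    by_cases hj : a⁻¹ ^ (j + 1) ∈ grid a n
    · simp only [indicator_of_mem (show j ∈ {j | a⁻¹ ^ (j + 1) ∈ grid a n} from hj)]
      exact ((hZm _).indicator (hg.measurableSet_rejection μ c₂ D a x n j)).const_mul _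
    · simp only [indicator_of_notMem (show j ∉ {j | a⁻¹ ^ (j + 1) ∈ grid a n} from hj)]
      exact measurable_const
  have hfirst : Measurable fun ω : Fin n → (ℝ × ℝ) × ℝ =>
      ENNReal.ofReal (3 * Ψ ^ 2 + 3 * b (a⁻¹ ^ J) ^ 2) +
        ENNReal.ofReal 3 * ENNReal.ofReal (stochErr μ x g (a⁻¹ ^ J) ω ^ 2) :=
    measurable_const.add ((hZm _).const_mul _)
  rw [lintegral_add_left hfirst,
    lintegral_add_left measurable_const, lintegral_const, measure_univ, mul_one,
    lintegral_const_mul _ (hZm _), lintegral_tsum fun j => (hterm j).aemeasurable]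
  have hsum : ∑' j : ℕ, ∫⁻ ω, {j | a⁻¹ ^ (j + 1) ∈ grid a n}.indicator
      (fun j => ENNReal.ofReal 2 * (rejection μ c₂ D a x g n j).indicator
        (fun ω => ENNReal.ofReal (stochErr μ x g (a⁻¹ ^ (j + 1)) ω ^ 2)) ω) j ∂(sampleLaw σ n) ≤
      ENNReal.ofReal (2 * (2 * ((momentConst μ σ L x + 4) / n))) := by
    refine le_trans (ENNReal.tsum_le_tsum fun j => ?_)
      (tsum_ofReal_geometric_le (r := a⁻¹) (by positivity) (by positivity) (inv_le_half ha))
    by_cases hj : a⁻¹ ^ (j + 1) ∈ grid a n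
    · simp only [indicator_of_mem (show j ∈ {j | a⁻¹ ^ (j + 1) ∈ grid a n} from hj)]
      rw [lintegral_const_mul _ ((hZm _).indicator (hg.measurableSet_rejection μ c₂ D a x n j)),
        mul_assoc, ENNReal.ofReal_mul zero_le_two]
      exact mul_le_mul_right (hg.lintegral_indicator_rejection_le μ σ x hc₂ hD ha hn j hj) _
    · simp only [indicator_of_notMem (show j ∉ {j | a⁻¹ ^ (j + 1) ∈ grid a n} from hj)]
      rw [lintegral_zero]
      exact zero_le
  refine (add_le_add (add_le_add_right (mul_le_mul_right (hg.lintegral_stochErr_sq_le μ σ x hJ0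
    (inv_pow_le_one ha J) (by omega) (one_le_mul_of_mem_grid hn hJ)) _) _) hsum).trans_eq ?_
  rw [← ENNReal.ofReal_mul (by norm_num), ← ENNReal.ofReal_add (by positivity) (by positivity),
    ← ENNReal.ofReal_add (by positivity) (by positivity)]
  congr 1
  ring

lemma lam_sq_le {D δ : ℝ} (hD : 0 ≤ D) {n : ℕ} (hn : 3 ≤ n) (hδ0 : 0 < δ) (hδ1 : δ ≤ 1)
    (hδ : Real.log (1 / δ) ≤ Real.log n) : lam D δ ^ 2 ≤ (1 + D) * Real.log n := by
  have h1 := one_le_log hn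
  have h0 : 0 ≤ Real.log (1 / δ) := Real.log_nonneg (by rw [le_div_iff₀ hδ0]; linarith)
  have h2 : D * Real.log (1 / δ) ≤ D * Real.log n := mul_le_mul_of_nonneg_left hδ hD
  rcases max_cases 1 √(D * Real.log (1 / δ)) with ⟨h, -⟩ | ⟨h, -⟩ <;> rw [lam, h]
  · nlinarith
  · rw [Real.sq_sqrt (by positivity)]
    linarith

lemma lam_antitone {D δ δ' : ℝ} (hD : 0 ≤ D) (hδ : 0 < δ) (h : δ ≤ δ') : lam D δ' ≤ lam D δ := by
  unfold lam
  have h' : 0 < δ' := hδ.trans_le h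
  gcongr

/-- Against the oracle bandwidth `η`, the threshold of a larger bandwidth is of the order of the
standard deviation at `η`, up to the logarithmic factor. -/
lemma threshold_le (μ : ℝ) {c₁ c₂ D : ℝ} (hc₁ : 0 < c₁) (hc₂ : 0 < c₂) (hD : 0 ≤ D) {n : ℕ}
    {δ η : ℝ} (hη : 0 < η) (hηδ : η ≤ δ) (hδ1 : δ ≤ 1) :
    threshold μ c₁ c₂ D n δ η ≤
      (√(c₁ * ((η ^ 3)⁻¹ / n)) + √(4 * c₂ * energyConst μ * ((η ^ 3)⁻¹ / n))) * lam D η := by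
  have hl := lam_antitone hD hη hηδ
  have h1 : vOne c₁ n δ ≤ √(c₁ * ((η ^ 3)⁻¹ / n)) := by
    refine Real.sqrt_le_sqrt ?_
    rw [mul_div_assoc]
    gcongr
  have h2 : vTwo μ c₂ n δ η ≤ √(4 * c₂ * energyConst μ * ((η ^ 3)⁻¹ / n)) := by
    refine Real.sqrt_le_sqrt ?_
    calc _ ≤ c₂ / n * (4 * energyConst μ * (η ^ 3)⁻¹) := by
          gcongr
          exact (integrable_filterK_sub_sq μ hη hηδ hδ1).2
      _ = _ := by ring
  rw [threshold, add_mul]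
  exact add_le_add (mul_le_mul h1 hl (lam_nonneg _ _) (Real.sqrt_nonneg _))
    (mul_le_mul_of_nonneg_right h2 (lam_nonneg _ _))

/-- The constant in front of the variance term of the oracle bound. -/
def oracleConst (μ σ L c₁ c₂ D : ℝ) (x : Plane) : ℝ :=
  6 * (c₁ + 4 * c₂ * energyConst μ) * (1 + D) + 3 * (1 + momentConst μ σ L x) +
    4 * (momentConst μ σ L x + 4)

lemma IsDensity.risk_le_oracle (hg : IsDensity L g) (hfg : f =ᵐ[volume] g) (μ σ : ℝ) (x : Plane)
    {c₁ c₂ D : ℝ} (hc₁ : 0 < c₁) (hc₂ : 0 < c₂) (hD0 : 0 ≤ D)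
    (hD : thresholdConst μ σ L c₂ x ≤ D) {a : ℝ} (ha : 2 ≤ a)
    {n : ℕ} (hn : 3 ≤ n) (b : ℝ → ℝ) (hb : ∀ δ, 0 < δ → |meanEst μ x g δ - f x| ≤ b δ)
    (hmono : ∀ δ δ', 0 < δ → δ ≤ δ' → b δ ≤ b δ') {J : ℕ} (hJ : a⁻¹ ^ J ∈ grid a n)
    (hbal : ∀ δ ∈ grid a n, δ ≤ a⁻¹ ^ J → 2 * b δ ≤ vOne c₁ n δ * lam D δ) :
    risk μ σ (n := n) (adaptiveEst μ c₁ c₂ D a x) f x ≤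
      ENNReal.ofReal (oracleConst μ σ L c₁ c₂ D x * (((a⁻¹ ^ J) ^ 3)⁻¹ * (Real.log n / n)) +
        3 * b (a⁻¹ ^ J) ^ 2) := by
  have hn' : (0 : ℝ) < n := by positivity
  have hMC := momentConst_pos μ σ L x
  have hJ0 := inv_pow_pos ha J
  have hJ1 := inv_pow_le_one ha J
  have hE := energyConst_pos μ
  have hlog := one_le_log hn
  refine (hg.risk_le hfg μ σ x hc₂ hD ha hn b hb hmono hJ hbal fun δ hδ hle =>
    threshold_le μ hc₁ hc₂ hD0 hJ0 hle hδ.1.2).trans (ENNReal.ofReal_le_ofReal ?_)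
  set η := a⁻¹ ^ J
  set V := (η ^ 3)⁻¹ / n with hV
  have hV0 : 0 < V := by positivity
  have hlam := lam_sq_le hD0 hn hJ0 hJ1 (log_inv_le_log hn hJ)
  have hVl : (η ^ 3)⁻¹ * (Real.log n / n) = V * Real.log n := by rw [hV]; ring
  have h1 : ((√(c₁ * V) + √(4 * c₂ * energyConst μ * V)) * lam D η) ^ 2 ≤
      2 * ((c₁ + 4 * c₂ * energyConst μ) * V) * ((1 + D) * Real.log n) := by
    rw [mul_pow]
    refine mul_le_mul ?_ hlam (sq_nonneg _) (by positivity)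
    have e1 := Real.sq_sqrt (by positivity : 0 ≤ c₁ * V)
    have e2 := Real.sq_sqrt (by positivity : 0 ≤ 4 * c₂ * energyConst μ * V)
    nlinarith [sq_nonneg (√(c₁ * V) - √(4 * c₂ * energyConst μ * V))]
  have h2 : V ≤ V * Real.log n := le_mul_of_one_le_right hV0.le hlog
  have h3 : 1 / (n : ℝ) ≤ V * Real.log n := by
    refine le_trans ?_ h2
    rw [hV]
    gcongr
    exact (one_le_inv₀ (by positivity)).2 (pow_le_one₀ hJ0.le hJ1)
  rw [hVl, oracleConst]
  have h4 := mul_le_mul_of_nonneg_left h2 (by positivity : 0 ≤ 3 * (1 + momentConst μ σ L x))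
  have h5 := mul_le_mul_of_nonneg_left h3 (by positivity : 0 ≤ 4 * (momentConst μ σ L x + 4))
  have e3 : 4 * ((momentConst μ σ L x + 4) / n) = 4 * (momentConst μ σ L x + 4) * (1 / n) := by
    ring
  rw [e3]
  linarith

/-- Below the bandwidth `κ (log n / n) ^ (1 / (2β + 1))` the bias is dominated by the threshold. -/
lemma bias_le_threshold {β B c₁ D κ : ℝ} (hβ : 1 < β) (hc₁ : 0 < c₁) (hD : 1 ≤ D)
    (hκ0 : 0 < κ) (hκ1 : κ ≤ 1)
    (hκ : 4 * B ^ 2 * κ ^ (2 * β + 1) ≤ c₁ * (1 / (2 * β + 1)) / 2) {n : ℕ} (hn : 3 ≤ n)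
    (hll : Real.log (Real.log n) ≤ Real.log n / 2) {δ : ℝ} (hδ : 0 < δ)
    (hδh : δ ≤ κ * (Real.log n / n) ^ (1 / (2 * β + 1))) :
    2 * (B * δ ^ (β - 1)) ≤ vOne c₁ n δ * lam D δ := by
  have hn' : (0 : ℝ) < n := by positivity
  have hlog := one_le_log hn
  have hlog0 : 0 < Real.log n := by linarith
  set p := 1 / (2 * β + 1) with hp
  have hp0 : 0 < p := by positivity
  have hpβ : p * (2 * β + 1) = 1 := by rw [hp]; field_simp
  set ε := Real.log n / n with hε
  have hε0 : 0 < ε := by positivity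
  have hεp : 0 < ε ^ p := by positivity
  have hlδ : p / 2 * Real.log n ≤ Real.log (1 / δ) := by
    have h1 : Real.log (ε ^ p) = p * (Real.log (Real.log n) - Real.log n) := by
      rw [Real.log_rpow hε0, hε, Real.log_div hlog0.ne' hn'.ne']
    have h2 : Real.log δ ≤ Real.log (ε ^ p) :=
      Real.log_le_log hδ (hδh.trans (mul_le_of_le_one_left hεp.le hκ1))
    rw [one_div, Real.log_inv]
    rw [h1] at h2
    nlinarith
  have hlδ0 : 0 < Real.log (1 / δ) := lt_of_lt_of_le (by positivity) hlδ
  have hpow : (δ ^ (β - 1)) ^ 2 * δ ^ 3 ≤ κ ^ (2 * β + 1) * ε := by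
    have e1 : (δ ^ (β - 1)) ^ 2 * δ ^ 3 = δ ^ (2 * β + 1) := by
      rw [← Real.rpow_natCast (δ ^ (β - 1)) 2, ← Real.rpow_mul hδ.le, ← Real.rpow_natCast δ 3,
        ← Real.rpow_add hδ]
      congr 1
      push_cast
      ring
    have e2 : (κ * ε ^ p) ^ (2 * β + 1) = κ ^ (2 * β + 1) * ε := by
      rw [Real.mul_rpow hκ0.le hεp.le, ← Real.rpow_mul hε0.le, hpβ, Real.rpow_one]
    rw [e1, ← e2]
    exact Real.rpow_le_rpow hδ.le hδh (by linarith)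
  have hsq : (2 * (B * δ ^ (β - 1))) ^ 2 ≤ c₁ * (δ ^ 3)⁻¹ / n * (D * Real.log (1 / δ)) := by
    calc (2 * (B * δ ^ (β - 1))) ^ 2 =
          4 * B ^ 2 * ((δ ^ (β - 1)) ^ 2 * δ ^ 3) * (δ ^ 3)⁻¹ := by field_simp; ring
      _ ≤ 4 * B ^ 2 * (κ ^ (2 * β + 1) * ε) * (δ ^ 3)⁻¹ := by gcongr
      _ = 4 * B ^ 2 * κ ^ (2 * β + 1) * (ε * (δ ^ 3)⁻¹) := by ring
      _ ≤ c₁ * p / 2 * (ε * (δ ^ 3)⁻¹) := by gcongr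
      _ = c₁ * (δ ^ 3)⁻¹ / n * (1 * (p / 2 * Real.log n)) := by rw [hε]; ring
      _ ≤ _ := by gcongr
  calc 2 * (B * δ ^ (β - 1)) ≤ √(c₁ * (δ ^ 3)⁻¹ / n * (D * Real.log (1 / δ))) :=
        Real.le_sqrt_of_sq_le hsq
    _ = √(c₁ * (δ ^ 3)⁻¹ / n) * √(D * Real.log (1 / δ)) := Real.sqrt_mul (by positivity) _
    _ ≤ _ := mul_le_mul_of_nonneg_left (le_max_right _ _) (Real.sqrt_nonneg _)

lemma exists_scale {β B c₁ : ℝ} (hβ : 1 < β) (hc₁ : 0 < c₁) :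
    ∃ κ : ℝ, 0 < κ ∧ κ ≤ 1 ∧ 4 * B ^ 2 * κ ^ (2 * β + 1) ≤ c₁ * (1 / (2 * β + 1)) / 2 := by
  set y := c₁ * (1 / (2 * β + 1)) / 2 / (4 * B ^ 2 + 1) with hy
  have hy0 : 0 < y := by positivity
  refine ⟨min 1 (y ^ (1 / (2 * β + 1))), by positivity, min_le_left _ _, ?_⟩
  have h1 : min 1 (y ^ (1 / (2 * β + 1))) ^ (2 * β + 1) ≤ y := by
    calc _ ≤ (y ^ (1 / (2 * β + 1))) ^ (2 * β + 1) :=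
          Real.rpow_le_rpow (by positivity) (min_le_right _ _) (by linarith)
      _ = y := by
          rw [← Real.rpow_mul hy0.le, one_div_mul_cancel (by linarith), Real.rpow_one]
  have h2 : y * (4 * B ^ 2 + 1) = c₁ * (1 / (2 * β + 1)) / 2 := by rw [hy]; field_simp
  nlinarith [mul_le_mul_of_nonneg_left h1 (by positivity : 0 ≤ 4 * B ^ 2)]

lemma tendsto_log_div_self : Tendsto (fun n : ℕ => Real.log n / n) atTop (nhds 0) :=
  (Real.isLittleO_log_id_atTop.tendsto_div_nhds_zero).comp tendsto_natCast_atTop_atTop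

/-- The oracle bound at the bandwidth of order `(log n / n) ^ (1 / (2β + 1))` has the rate
`(log n / n) ^ ((2β - 2) / (2β + 1))`. -/
lemma oracle_rate {β B κ a K : ℝ} (hβ : 1 < β) (hκ0 : 0 < κ) (hκ1 : κ ≤ 1) (ha : 2 ≤ a)
    (hK : 0 ≤ K) {ε η : ℝ} (hε : 0 < ε)
    (hη : a⁻¹ * (κ * ε ^ (1 / (2 * β + 1))) ≤ η) (hη' : η ≤ κ * ε ^ (1 / (2 * β + 1))) :
    K * ((η ^ 3)⁻¹ * ε) + 3 * (B * η ^ (β - 1)) ^ 2 ≤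
      (K * (a ^ 3 * (κ ^ 3)⁻¹) + 3 * B ^ 2) * ε ^ ((2 * β - 2) / (2 * β + 1)) := by
  set p := 1 / (2 * β + 1) with hp
  have hεp : 0 < ε ^ p := by positivity
  have hη0 : 0 < η := lt_of_lt_of_le (by positivity) hη
  have h1 : (η ^ 3)⁻¹ * ε ≤ a ^ 3 * (κ ^ 3)⁻¹ * ε ^ ((2 * β - 2) / (2 * β + 1)) := by
    have e : ε ^ ((2 * β - 2) / (2 * β + 1)) = ((ε ^ p) ^ 3)⁻¹ * ε := by
      rw [← Real.rpow_natCast (ε ^ p) 3, ← Real.rpow_mul hε.le, ← Real.rpow_neg hε.le]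
      nth_rw 3 [← Real.rpow_one ε]
      rw [← Real.rpow_add hε]
      congr 1
      rw [hp]
      push_cast
      field_simp
      ring
    calc (η ^ 3)⁻¹ * ε ≤ ((a⁻¹ * (κ * ε ^ p)) ^ 3)⁻¹ * ε := by gcongr
      _ = _ := by rw [e]; field_simp
  have h2 : (B * η ^ (β - 1)) ^ 2 ≤ B ^ 2 * ε ^ ((2 * β - 2) / (2 * β + 1)) := by
    have e : ε ^ ((2 * β - 2) / (2 * β + 1)) = ((ε ^ p) ^ (β - 1)) ^ 2 := by
      rw [← Real.rpow_natCast _ 2, ← Real.rpow_mul hε.le, ← Real.rpow_mul hε.le]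
      congr 1
      rw [hp]
      push_cast
      field_simp
    have hη1 : η ≤ ε ^ p := hη'.trans (mul_le_of_le_one_left hεp.le hκ1)
    rw [mul_pow, e]
    gcongr
  have h3 := mul_le_mul_of_nonneg_left h1 hK
  linarith

end ERT

end

theorem theorem3 (μ σ L c₁ c₂ : ℝ) (hσ : 0 < σ) (hL : 0 < L) (hc₁ : 0 < c₁) (hc₂ : 0 < c₂)
    (x : ERT.Plane) :
    ∃ D₀ : ℝ, ∀ D : ℝ, D₀ ≤ D → ∀ a : ℝ, 2 ≤ a → ∀ β : ℝ, 1 < β → ∀ C : ℝ, 0 < C →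
      limsup (fun n : ℕ =>
        ⨆ f ∈ {f | f ∈ ERT.sobolevBall β C ∩ ERT.classB L ∧ ContinuousAt f x},
          ENNReal.ofReal (((n : ℝ) / Real.log n) ^ ((2 * β - 2) / (2 * β + 1))) *
            ERT.risk μ σ (n := n) (ERT.adaptiveEst μ c₁ c₂ D a x) f x) atTop < ⊤ := by
  refine ⟨ERT.thresholdConst μ σ L c₂ x, fun D hD a ha β hβ C hC => ?_⟩
  have hD1 : 1 ≤ D := by
    refine le_trans ?_ hD
    have h1 := ERT.noiseConst_nonneg σ (ERT.transformBound μ L)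
    have h2 := ERT.one_le_freqRatio μ
    have h3 : 0 ≤ 100 * ERT.noiseConst σ (ERT.transformBound μ L) *
      ERT.weightBound μ x ^ 2 / c₂ := by positivity
    have h4 : 0 ≤ 80000 * ERT.weightBound μ x ^ 2 * ERT.freqRatio μ / c₂ := by positivity
    unfold ERT.thresholdConst
    linarith
  set B := ERT.biasConst β C with hB
  have hB0 : 0 ≤ B := add_nonneg (ERT.tailMass_nonneg β) hC.le
  obtain ⟨κ, hκ0, hκ1, hκ⟩ := ERT.exists_scale (B := B) hβ hc₁
  set K := ERT.oracleConst μ σ L c₁ c₂ D x with hK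
  have hK0 : 0 ≤ K := by
    have h1 := ERT.momentConst_pos μ σ L x
    have h2 := ERT.energyConst_pos μ
    rw [hK, ERT.oracleConst]
    positivity
  set p := 1 / (2 * β + 1) with hp
  have hp0 : 0 < p := by positivity
  have hp1 : 0 < 1 - p := by
    rw [hp, sub_pos, div_lt_one (by linarith)]
    linarith
  have hev1 : ∀ᶠ n : ℕ in atTop, (Real.log n / n) ^ (1 - p) < a⁻¹ * κ := by
    have := ERT.tendsto_log_div_self.rpow_const (p := 1 - p) (Or.inr hp1.le)
    rw [Real.zero_rpow hp1.ne'] at this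
    exact this.eventually_lt_const (by positivity)
  have hev2 : ∀ᶠ n : ℕ in atTop, Real.log (Real.log n) ≤ Real.log n / 2 := by
    have h1 := (Real.isLittleO_log_id_atTop.comp_tendsto
      (Real.tendsto_log_atTop.comp (tendsto_natCast_atTop_atTop (R := ℝ)))).bound
        (by norm_num : (0 : ℝ) < 1 / 2)
    filter_upwards [h1, eventually_ge_atTop 3] with n hn hn3
    have h2 := ERT.one_le_log hn3
    simp only [Function.comp_def, id, Real.norm_eq_abs] at hn
    rw [abs_of_nonneg (by linarith : 0 ≤ Real.log n)] at hn
    linarith [le_abs_self (Real.log (Real.log n))]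
  refine lt_of_le_of_lt (b := ENNReal.ofReal (K * (a ^ 3 * (κ ^ 3)⁻¹) + 3 * B ^ 2)) ?_
    ENNReal.ofReal_lt_top
  refine limsup_le_of_le (by isBoundedDefault) ?_
  filter_upwards [hev1, hev2, eventually_ge_atTop 3] with n h1 h2 hn
  refine iSup₂_le fun f hf => ?_
  obtain ⟨⟨hfH, hfB⟩, hfx⟩ := hf
  obtain ⟨g, hg, hfg⟩ := ERT.exists_isDensity hfB
  have hn' : (0 : ℝ) < n := by positivity
  have hlog := ERT.one_le_log hn
  set ε := Real.log n / n with hε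
  have hε0 : 0 < ε := by positivity
  have hε1 : ε ≤ 1 := by
    rw [hε, div_le_one hn']
    exact Real.log_le_self hn'.le
  have hεp : 0 < ε ^ p := by positivity
  have hh1 : κ * ε ^ p ≤ 1 := mul_le_one₀ hκ1 hεp.le (Real.rpow_le_one hε0.le hε1 hp0.le)
  -- the oracle bandwidth is the largest grid point below `κ * ε ^ p`
  obtain ⟨i, hi1, hi2⟩ := exists_nat_pow_near_of_lt_one (by positivity : 0 < κ * ε ^ p) hh1
    (by positivity : 0 < a⁻¹) (by linarith [ERT.inv_le_half ha])
  have hlow : a⁻¹ * (κ * ε ^ p) ≤ a⁻¹ ^ (i + 1) := by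
    rw [pow_succ']
    gcongr
  have hgrid : a⁻¹ ^ (i + 1) ∈ ERT.grid a n := by
    refine ⟨⟨le_trans ?_ hlow, ERT.inv_pow_le_one ha _⟩, _, rfl⟩
    calc ε = ε ^ (1 - p) * ε ^ p := by
          rw [← Real.rpow_add hε0, sub_add_cancel, Real.rpow_one]
      _ ≤ a⁻¹ * κ * ε ^ p := by gcongr
      _ = _ := by ring
  have hrisk := hg.risk_le_oracle hfg μ σ x hc₁ hc₂ (by linarith) hD ha hn
    (fun δ => B * δ ^ (β - 1))
    (fun δ hδ => ERT.abs_bias_le hβ hC hfH hg hfg hfx μ hδ)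
    (fun δ δ' hδ hle => by
      have : δ ^ (β - 1) ≤ δ' ^ (β - 1) := Real.rpow_le_rpow hδ.le hle (by linarith)
      gcongr) hgrid
    (fun δ hδ hle => ERT.bias_le_threshold hβ hc₁ hD1 hκ0 hκ1 hκ hn h2 (ERT.grid_pos hn hδ)
      (hle.trans hi1.le))
  have hrate := ERT.oracle_rate (B := B) hβ hκ0 hκ1 ha hK0 hε0 hlow hi1.le
  have hinv : ((n : ℝ) / Real.log n) ^ ((2 * β - 2) / (2 * β + 1)) *
      ε ^ ((2 * β - 2) / (2 * β + 1)) = 1 := by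
    rw [← Real.mul_rpow (by positivity) hε0.le, hε, div_mul_div_cancel₀ (by linarith),
      div_self hn'.ne', Real.one_rpow]
  refine (mul_le_mul_right (hrisk.trans (ENNReal.ofReal_le_ofReal hrate)) _).trans ?_
  rw [← ENNReal.ofReal_mul (by positivity), mul_left_comm, hinv, mul_one]
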